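/- Let $f:\mathbb R^n\to\mathbb R$ be twice continuously differentiable and strongly convex with modulus $\mu_f\ge 0$ (merely convex if $\mu_f=0$), with $\nabla f$ Lipschitz continuous with constant $L_f\ge 0$, and let $g:\mathbb R^n\to\mathbb R\cup\{+\infty\}$ be proper, lower semicontinuous and convex. Let $\gamma\in(0,1/L_f)$ (any $\gamma>0$ if $L_f=0$), $\sigma\in(0,1/2)$, $\bar\eta\in(0,1)$, $\zeta\in(0,1)$, $\rho\in(0,1]$. Put $$\operatorname{prox}_{\gamma g}(x)=\operatorname*{argmin}_u\Big\{g(u)+\tfrac1{2\gamma}\|u-x\|^2\Big\},\qquad g^\gamma(x)=\inf_u\Big\{g(u)+\tfrac1{2\gamma}\|u-x\|^2\Big\},$$ $$F_\gamma(x)=f(x)-\tfrac{\gamma}{2}\|\nabla f(x)\|^2+g^\gamma(x-\gamma\nabla f(x)),$$ which is continuously differentiable. For a mapping $G:\mathbb R^n\to\mathbb R^n$ that is Lipschitz around a point $x$, let $\partial_BG(x)$ be the set of all limits of Jacobians of $G$ along sequences of points of differentiability converging to $x$, and $\partial_CG(x)$ its convex hull. A mapping $G$ that is Lipschitz around $\bar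 x$ is semismooth at $\bar x$ if $\|G(x)+H(\bar x-x)-G(\bar x)\|=o(\|x-\bar x\|)$ as $x\to\bar x$, uniformly over $H\in\partial_CG(x)$, and strongly semismooth at $\bar x$ if $o(\|x-\bar x\|)$ can be replaced by $O(\|x-\bar x\|^2)$. Let $$\hat\partial^2F_\gamma(x)=\big\{\gamma^{-1}(I-\gamma\nabla^2f(x))\big(I-P(I-\gamma\nabla^2f(x))\big)\ :\ P\in\partial_C(\operatorname{prox}_{\gamma g})(x-\gamma\nabla f(x))\big\}.$$ Let $\{x^k\}$ be generated from an arbitrary $x^0\in\mathbb R^n$ by the following method (forward-backward Newton-CG). For $k=0,1,2,\dots$: select any $H^k\in\hat\partial^2F_\gamma(x^k)$; with $\delta_k=\zeta\|\nabla F_\gamma(x^k)\|$ and $\eta_k=\min\{\bar\eta,\|\nabla F_\gamma(x^k)\|^\rho\}$, let $d^k$ be an iterate of the conjugate gradient method, started at $0$ and applied to $(H^k+\delta_kI)d=-\nabla F_\gamma(x^k)$, that satisfies $$\|(H^k+\delta_kI)d^k+\nabla F_\gamma(x^k)\|\le\eta_k\|\nabla F_\gamma(x^k)\|;$$ let $\tau_k$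 be the largest number in $\{2^{-i}:i=0,1,2,\dots\}$ with $$F_\gamma(x^k+\tau_kd^k)\le F_\gamma(x^k)+\sigma\tau_k\langle\nabla F_\gamma(x^k),d^k\rangle,$$ and set $x^{k+1}=x^k+\tau_kd^k$. Suppose that $x_\star$ is an accumulation point of $\{x^k\}$, that $\operatorname{prox}_{\gamma g}$ is semismooth at $x_\star-\gamma\nabla f(x_\star)$, and that every element of $\hat\partial^2F_\gamma(x_\star)$ is nonsingular. Then the entire sequence $\{x^k\}$ converges to $x_\star$, and the convergence is Q-superlinear: $\|x^{k+1}-x_\star\|=o(\|x^k-x_\star\|)$. If, furthermore, $\operatorname{prox}_{\gamma g}$ is strongly semismooth at $x_\star-\gamma\nabla f(x_\star)$ and $\nabla^2f$ is Lipschitz continuous on a neighbourhood of $x_\star$, then $\{x^k\}$ converges to $x_\star$ with Q-order at least $1+\rho$: there is a constant $C$ with $\|x^{k+1}-x_\star\|\le C\|x^k-x_\star\|^{1+\rho}$ for all sufficiently large $k$. -/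

import Mathlib

open Filter Topology Asymptotics

namespace FBNCG

noncomputable section

section General

variable {E : Type*} [NormedAddCommGroup E] [InnerProductSpace ℝ E] [CompleteSpace E]

/-- The class of twice continuously differentiable functions that are strongly convex with
modulus `μ ≥ 0` (plain convexity if `μ = 0`) and whose gradient is Lipschitz with constant `L`. -/
structure SmoothClass (μ : ℝ) (L : NNReal) (f : E → ℝ) : Prop where
  modulus_nonneg : 0 ≤ μ
  contDiff : ContDiff ℝ 2 f
  strongConvex : StrongConvexOn Set.univ μ f
  lipschitz_gradient : LipschitzWith L (gradient f)

/-- Proper, lower semicontinuous, convex functions with values in the extended reals;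
convexity is convexity of the epigraph. -/
structure ProperLscConvex (g : E → EReal) : Prop where
  ne_bot : ∀ x, g x ≠ ⊥
  exists_ne_top : ∃ x, g x ≠ ⊤
  lsc : LowerSemicontinuous g
  convex : Convex ℝ {p : E × ℝ | g p.1 ≤ (p.2 : EReal)}

/-- The objective `u ↦ g u + ‖u - x‖² / (2γ)` of the proximal subproblem. -/
def proxObj (γ : ℝ) (g : E → EReal) (x u : E) : EReal :=
  g u + ((‖u - x‖ ^ 2 / (2 * γ) : ℝ) : EReal)

/-- The proximal mapping of `γ g`: a global minimizer of the proximal objective. For `γ > 0`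
and `g` proper, lower semicontinuous and convex it exists and is unique. -/
def prox (γ : ℝ) (g : E → EReal) (x : E) : E :=
  Classical.epsilon fun u => ∀ v, proxObj γ g x u ≤ proxObj γ g x v

/-- The Moreau envelope of `g`, as an extended real number. -/
def moreau (γ : ℝ) (g : E → EReal) (x : E) : EReal :=
  ⨅ u, proxObj γ g x u

/-- The forward-backward envelope of `f + g`. The Moreau envelope is finite whenever `γ > 0`
and `g` is proper, lower semicontinuous and convex, so `toReal` loses nothing there. -/
def fbe (f : E → ℝ) (g : E → EReal) (γ : ℝ) (x : E) : ℝ :=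
  f x - γ / 2 * ‖gradient f x‖ ^ 2 + (moreau γ g (x - γ • gradient f x)).toReal

/-- The Hessian of `f`, as an operator: the derivative of the gradient. -/
def hess (f : E → ℝ) (x : E) : E →L[ℝ] E :=
  fderiv ℝ (gradient f) x

/-- The B-subdifferential (limiting Jacobian) of `G` at `x`. -/
def bSubdiff (G : E → E) (x : E) : Set (E →L[ℝ] E) :=
  {H | ∃ y : ℕ → E, (∀ k, DifferentiableAt ℝ G (y k)) ∧ Tendsto y atTop (𝓝 x) ∧
    Tendsto (fun k => fderiv ℝ G (y k)) atTop (𝓝 H)}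

/-- The Clarke generalized Jacobian of `G` at `x`. -/
def clarke (G : E → E) (x : E) : Set (E →L[ℝ] E) :=
  convexHull ℝ (bSubdiff G x)

/-- `G` is Lipschitz on a neighbourhood of `a`. -/
def LipschitzAround {X Y : Type*} [PseudoEMetricSpace X] [PseudoEMetricSpace Y]
    (G : X → Y) (a : X) : Prop :=
  ∃ K : NNReal, ∃ U ∈ 𝓝 a, LipschitzOnWith K G U

/-- Semismoothness at `a`: `‖G x + H (a - x) - G a‖ = o(‖x - a‖)` as `x → a`, uniformly over
the elements `H` of the generalized Jacobian at `x`. -/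
def SemismoothAt (G : E → E) (a : E) : Prop :=
  LipschitzAround G a ∧
    ∀ ε > 0, ∀ᶠ x in 𝓝 a, ∀ H ∈ clarke G x, ‖G x + H (a - x) - G a‖ ≤ ε * ‖x - a‖

/-- Strong semismoothness at `a`: the same with `O(‖x - a‖²)`. -/
def StronglySemismoothAt (G : E → E) (a : E) : Prop :=
  LipschitzAround G a ∧
    ∃ C : ℝ, ∀ᶠ x in 𝓝 a, ∀ H ∈ clarke G x, ‖G x + H (a - x) - G a‖ ≤ C * ‖x - a‖ ^ 2

/-- The approximate generalized Hessian of the forward-backward envelope: all operators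
`γ⁻¹ (I - γ ∇²f(x)) (I - P (I - γ ∇²f(x)))`, `P` in the generalized Jacobian of the proximal
mapping at `x - γ ∇f(x)`. -/
def approxHess (f : E → ℝ) (g : E → EReal) (γ : ℝ) (x : E) : Set (E →L[ℝ] E) :=
  {H | ∃ P ∈ clarke (prox γ g) (x - γ • gradient f x),
    H = γ⁻¹ • ((1 - γ • hess f x) * (1 - P * (1 - γ • hess f x)))}

/-- State of the conjugate gradient method: iterate, residual, search direction. -/
structure CGState (E : Type*) where
  pt : E
  res : E
  dir : E

/-- One step of the conjugate gradient method for `A d = b`. -/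
def cgStep (A : E →L[ℝ] E) (s : CGState E) : CGState E :=
  let α : ℝ := inner ℝ s.res s.res / inner ℝ s.dir (A s.dir)
  let r : E := s.res - α • A s.dir
  { pt := s.pt + α • s.dir
    res := r
    dir := r + (inner ℝ r r / inner ℝ s.res s.res : ℝ) • s.dir }

/-- The conjugate gradient method for `A d = b`, started at `d = 0`. After the residual has
vanished, both quotients in a step are `0 / 0 = 0` and the iterate no longer changes. -/
def cg (A : E →L[ℝ] E) (b : E) : ℕ → CGState E
  | 0 => { pt := 0, res := b, dir := b }
  | j + 1 => cgStep A (cg A b j)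

/-- The regularization parameter `δ` at the point `x`. -/
def regParam (f : E → ℝ) (g : E → EReal) (γ ζ : ℝ) (x : E) : ℝ :=
  ζ * ‖gradient (fbe f g γ) x‖

/-- The forcing term `η` at the point `x`. -/
def forcing (f : E → ℝ) (g : E → EReal) (γ ηbar ρ : ℝ) (x : E) : ℝ :=
  min ηbar (‖gradient (fbe f g γ) x‖ ^ ρ)

/-- The sequences of iterates `x`, generalized Hessians `H`, directions `d` and stepsizes `τ`
generated by the forward-backward Newton-CG method. -/
structure IsRun (f : E → ℝ) (g : E → EReal) (γ σ ηbar ζ ρ : ℝ)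
    (x : ℕ → E) (H : ℕ → E →L[ℝ] E) (d : ℕ → E) (τ : ℕ → ℝ) : Prop where
  /-- an element of the approximate generalized Hessian is selected -/
  hess_mem : ∀ k, H k ∈ approxHess f g γ (x k)
  /-- the direction is an iterate of CG applied to the regularized Newton system -/
  dir_cg : ∀ k, ∃ j : ℕ,
    d k = (cg (H k + regParam f g γ ζ (x k) • 1) (-gradient (fbe f g γ) (x k)) j).pt
  /-- that solves the system to the prescribed accuracy -/
  dir_accuracy : ∀ k,
    ‖(H k + regParam f g γ ζ (x k) • (1 : E →L[ℝ] E)) (d k) + gradient (fbe f g γ) (x k)‖ ≤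
      forcing f g γ ηbar ρ (x k) * ‖gradient (fbe f g γ) (x k)‖
  /-- the stepsize is the largest power of `1/2` that gives sufficient decrease -/
  step_armijo : ∀ k, IsGreatest
    {t : ℝ | (∃ i : ℕ, t = (1 / 2 : ℝ) ^ i) ∧
      fbe f g γ (x k + t • d k) ≤
        fbe f g γ (x k) + σ * t * inner ℝ (gradient (fbe f g γ) (x k)) (d k)} (τ k)
  /-- update of the iterate -/
  update : ∀ k, x (k + 1) = x k + τ k • d k

/-- Convergence of the whole sequence to `a` with Q-superlinear rate. -/
def QSuperlinear (x : ℕ → E) (a : E) : Prop :=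
  Tendsto x atTop (𝓝 a) ∧ (fun k => x (k + 1) - a) =o[atTop] (fun k => x k - a)

/-- Convergence of the whole sequence to `a` with Q-order at least `q`. -/
def QOrderAtLeast (q : ℝ) (x : ℕ → E) (a : E) : Prop :=
  Tendsto x atTop (𝓝 a) ∧ ∃ C : ℝ, ∀ᶠ k in atTop, ‖x (k + 1) - a‖ ≤ C * ‖x k - a‖ ^ q

end General

end

end FBNCG

/-! The envelope `fbe` is continuously differentiable with gradient `γ⁻¹ Q(x) R(x)`, where `Q = 1 -
γ∇²f` is symmetric with `0 < 1 - γL ≤ Q ≤ 1` and `R` is the forward-backward residual. Generalized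
Jacobians `P` of the proximal mapping are symmetric with norm at most one, so every `γ⁻¹ Q (1 - P
Q)` is symmetric positive semidefinite. Nonsingularity at `xs` therefore means positive
definiteness, and compactness makes it uniform near `xs` (`exists_approxHess_ge`).

A CG iterate `d` started at zero satisfies `⟪b, d⟫ = ⟪A d, d⟫`, however inexact it is
(`inner_cg_pt`). With `b = -∇F` this gives exact control of the slope `⟪∇F, d⟫`. Near a
nonstationary `xs`, the directions would have length bounded above and below and steep slope, so
Armijo's rule would yield a fixed decrease infinitely often, which is impossible for a decreasing
sequence of values bounded below by `F(xs)`. Hence `∇F(xs) = 0`, and then `R(xs) = 0`.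

At a zero of `R`, semismoothness gives `∇F(x) - H(x - xs) = o(‖x - xs‖)`. Together with `H ≥ c`, `δ
= O(‖x - xs‖)` and `η → 0`, the full step satisfies `‖x + d - xs‖ = o(‖x - xs‖)`. The delicate point
is that the unit step passes Armijo's test although `F` need not be twice differentiable. The
substitute for a second-order expansion is the trapezoidal rule `F(x) - F(xs) = ½⟪∇F(x), x - xs⟫ +
o(‖x - xs‖²)` (`eventually_fbe_trapezoid`), which combined with `σ < 1/2` accepts the step. An
iterate close enough to `xs` then starts a contraction, so the whole sequence converges with the
rate of the full steps. -/

namespace FBNCG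

/-! ### Conjugate gradients: orthogonality and the Galerkin identity. -/

section CG

variable {E : Type*} [NormedAddCommGroup E] [InnerProductSpace ℝ E]
  {A : E →L[ℝ] E} {b : E}

open RealInnerProductSpace

lemma cg_succ_res (j : ℕ) : (cg A b (j + 1)).res = (cg A b j).res -
    (⟪(cg A b j).res, (cg A b j).res⟫ / ⟪(cg A b j).dir, A (cg A b j).dir⟫) •
      A (cg A b j).dir := rfl

lemma cg_succ_pt (j : ℕ) : (cg A b (j + 1)).pt = (cg A b j).pt +
    (⟪(cg A b j).res, (cg A b j).res⟫ / ⟪(cg A b j).dir, A (cg A b j).dir⟫) •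
      (cg A b j).dir := rfl

lemma cg_succ_dir (j : ℕ) : (cg A b (j + 1)).dir = (cg A b (j + 1)).res +
    (⟪(cg A b (j + 1)).res, (cg A b (j + 1)).res⟫ / ⟪(cg A b j).res, (cg A b j).res⟫) •
      (cg A b j).dir := rfl

lemma cg_res_eq (j : ℕ) : (cg A b j).res = b - A (cg A b j).pt := by
  induction j with
  | zero => simp [cg]
  | succ j ih => rw [cg_succ_res, cg_succ_pt, map_add, map_smul, ← sub_sub, ← ih]

lemma cg_dir_eq_zero {j : ℕ} (h : (cg A b j).res = 0) : (cg A b j).dir = 0 := by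
  cases j with
  | zero => exact h
  | succ j => rw [cg_succ_dir, h]; simp

/-- Covers a stationary iterate: there the regularization vanishes and the system may be only
semidefinite, so the orthogonality relations are not available. -/
lemma cg_zero_pt (j : ℕ) : (cg A 0 j).pt = 0 := by
  have h : (cg A 0 j).pt = 0 ∧ (cg A 0 j).res = 0 ∧ (cg A 0 j).dir = 0 := by
    induction j with
    | zero => simp [cg]
    | succ j ih =>
      obtain ⟨h1, h2, h3⟩ := ih
      have hr : (cg A 0 (j + 1)).res = 0 := by rw [cg_succ_res, h2, h3]; simp
      exact ⟨by rw [cg_succ_pt, h1, h3]; simp, hr, cg_dir_eq_zero hr⟩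
  exact h.1

lemma inner_res_of_inner_dir {v : E} {j : ℕ} (h : ∀ i ≤ j, ⟪v, (cg A b i).dir⟫ = 0) :
    ⟪v, (cg A b j).res⟫ = 0 := by
  cases j with
  | zero => exact h 0 le_rfl
  | succ j =>
    have h1 := h (j + 1) le_rfl
    rwa [cg_succ_dir, inner_add_right, inner_smul_right, h j (by omega), mul_zero,
      add_zero] at h1

/-- Orthogonality of the residuals and conjugacy of the directions. -/
lemma cg_orthogonality (hA : ∀ u v, ⟪A u, v⟫ = ⟪u, A v⟫) (hpos : ∀ v, v ≠ 0 → 0 < ⟪v, A v⟫)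
    (j : ℕ) :
    (∀ i < j, ⟪(cg A b j).res, (cg A b i).dir⟫ = 0) ∧
    (∀ i < j, ⟪(cg A b j).dir, A (cg A b i).dir⟫ = 0) ∧
    ⟪(cg A b j).res, (cg A b j).dir⟫ = ⟪(cg A b j).res, (cg A b j).res⟫ := by
  induction j with
  | zero => exact ⟨by simp, by simp, rfl⟩
  | succ j ih =>
    obtain ⟨h1, h2, h3⟩ := ih
    have hpp : ∀ i, (cg A b i).dir ≠ 0 →
        0 < ⟪(cg A b i).res, (cg A b i).res⟫ / ⟪(cg A b i).dir, A (cg A b i).dir⟫ := by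
      intro i hi
      refine div_pos (real_inner_self_pos.2 fun h => hi (cg_dir_eq_zero h)) (hpos _ hi)
    have hrp : ∀ i < j + 1, ⟪(cg A b (j + 1)).res, (cg A b i).dir⟫ = 0 := by
      intro i hi
      rw [cg_succ_res, inner_sub_left, inner_smul_left]
      rcases Nat.lt_succ_iff_lt_or_eq.1 hi with hi | rfl
      · rw [h1 i hi, hA, h2 i hi]; simp
      · by_cases hp : (cg A b i).dir = 0
        · simp [hp]
        · have := (hpos _ hp).ne'
          rw [h3, hA]
          simp only [conj_trivial]
          field_simp
          ring
    have hrr : ∀ i < j + 1, ⟪(cg A b (j + 1)).res, (cg A b i).res⟫ = 0 := fun i hi =>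
      inner_res_of_inner_dir fun l hl => hrp l (by omega)
    -- The residual update expresses `A p_i` as `(r_i - r_{i+1}) / α_i`, which turns conjugacy into
    -- orthogonality of residuals. For `i < j` both products vanish; for `i = j` the surviving term
    -- is the one that the coefficient in the direction update cancels.
    have key : ∀ i, ⟪(cg A b (j + 1)).res, (cg A b i).res⟫ = 0 → (cg A b i).dir ≠ 0 →
        ⟪(cg A b (j + 1)).res, A (cg A b i).dir⟫ =
        - ⟪(cg A b (j + 1)).res, (cg A b (i + 1)).res⟫ /
        (⟪(cg A b i).res, (cg A b i).res⟫ / ⟪(cg A b i).dir, A (cg A b i).dir⟫) := by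
      intro i hi hd
      have := (hpp i hd).ne'
      rw [eq_div_iff this, cg_succ_res i, inner_sub_right, inner_smul_right, hi]
      ring
    refine ⟨hrp, ?_, ?_⟩
    · intro i hi
      by_cases hp : (cg A b i).dir = 0
      · simp [hp]
      rw [cg_succ_dir, inner_add_left, inner_smul_left, key i (hrr i hi) hp]
      rcases Nat.lt_succ_iff_lt_or_eq.1 hi with hi | rfl
      · rw [h2 i hi, hrr (i + 1) (by omega)]; simp
      · have h4 := (hpos _ hp).ne'
        have h5 : ⟪(cg A b i).res, (cg A b i).res⟫ ≠ 0 :=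
          (real_inner_self_pos.2 fun h => hp (cg_dir_eq_zero h)).ne'
        simp only [conj_trivial]
        field_simp
        ring
    · conv_lhs => rw [cg_succ_dir, inner_add_right, inner_smul_right, hrp j (by omega)]
      simp

/-- The residual of a conjugate gradient iterate is orthogonal to the iterate. -/
lemma inner_cg_res_pt (hA : ∀ u v, ⟪A u, v⟫ = ⟪u, A v⟫) (hpos : ∀ v, v ≠ 0 → 0 < ⟪v, A v⟫)
    (j : ℕ) : ⟪(cg A b j).res, (cg A b j).pt⟫ = 0 := by
  have h : ∀ i ≤ j, ⟪(cg A b j).res, (cg A b i).pt⟫ = 0 := by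
    intro i
    induction i with
    | zero => intro _; simp [cg]
    | succ i ih =>
      intro hi
      rw [cg_succ_pt, inner_add_right, inner_smul_right, ih (by omega),
        (cg_orthogonality hA hpos j).1 i (by omega)]
      simp
  exact h j le_rfl

/-- `⟪b, d⟫ = ⟪A d, d⟫` for every conjugate gradient iterate `d`. -/
lemma inner_cg_pt (hA : ∀ u v, ⟪A u, v⟫ = ⟪u, A v⟫)
    (hpos : b ≠ 0 → ∀ v, v ≠ 0 → 0 < ⟪v, A v⟫) (j : ℕ) :
    ⟪b, (cg A b j).pt⟫ = ⟪A (cg A b j).pt, (cg A b j).pt⟫ := by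
  by_cases hb : b = 0
  · subst hb; rw [cg_zero_pt]; simp
  · have := inner_cg_res_pt (b := b) hA (hpos hb) j
    rw [cg_res_eq, inner_sub_left] at this
    linarith

end CG

/-! ### Symmetric positive semidefinite operators and symmetry of second derivatives. -/

section Operators

variable {E : Type*} [NormedAddCommGroup E] [InnerProductSpace ℝ E] {A : E →L[ℝ] E}

open RealInnerProductSpace

/-- Cocoercivity of a symmetric positive semidefinite operator. -/
lemma norm_sq_le_of_symm_nonneg (hA : ∀ u v, ⟪A u, v⟫ = ⟪u, A v⟫) (hpos : ∀ v, 0 ≤ ⟪A v, v⟫)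
    {L : ℝ} (hL : ‖A‖ ≤ L) (v : E) : ‖A v‖ ^ 2 ≤ L * ⟪A v, v⟫ := by
  -- The form is evaluated at `v + t • A v`. The choice `t = -1 / L` minimizes the resulting
  -- quadratic in `t`.
  have h : ∀ t : ℝ, 0 ≤ ⟪A v, v⟫ + 2 * t * ‖A v‖ ^ 2 + t ^ 2 * (L * ‖A v‖ ^ 2) := by
    intro t
    have h1 := hpos (v + t • A v)
    have h2 : ⟪A (A v), A v⟫ ≤ L * ‖A v‖ ^ 2 := by
      calc ⟪A (A v), A v⟫ ≤ ‖A (A v)‖ * ‖A v‖ := real_inner_le_norm _ _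
        _ ≤ (L * ‖A v‖) * ‖A v‖ := by gcongr; exact A.le_of_opNorm_le hL _
        _ = _ := by ring
    have h3 : ⟪A (v + t • A v), v + t • A v⟫ =
        ⟪A v, v⟫ + 2 * t * ‖A v‖ ^ 2 + t ^ 2 * ⟪A (A v), A v⟫ := by
      simp only [map_add, map_smul, inner_add_left, inner_add_right, inner_smul_left,
        inner_smul_right, conj_trivial, hA (A v) v, real_inner_self_eq_norm_sq]
      ring
    nlinarith [sq_nonneg t]
  have hL0 : 0 ≤ L := (norm_nonneg _).trans hL
  rcases hL0.eq_or_lt with h0 | h0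
  · have : A v = 0 := by
      have := A.le_of_opNorm_le hL v
      rw [← h0, zero_mul] at this
      simpa using this
    simp [this]
  · have h1 := h (-1 / L)
    have h2 : ⟪A v, v⟫ + 2 * (-1 / L) * ‖A v‖ ^ 2 + (-1 / L) ^ 2 * (L * ‖A v‖ ^ 2) =
        (L * ⟪A v, v⟫ - ‖A v‖ ^ 2) / L := by field_simp; ring
    rw [h2] at h1
    have := mul_nonneg h1 h0.le
    rw [div_mul_cancel₀ _ h0.ne'] at this
    linarith

/-- A symmetric positive semidefinite injective operator is positive definite. -/
lemma inner_pos_of_symm_nonneg (hA : ∀ u v, ⟪A u, v⟫ = ⟪u, A v⟫) (hpos : ∀ v, 0 ≤ ⟪A v, v⟫)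
    (hinj : Function.Injective A) {v : E} (hv : v ≠ 0) : 0 < ⟪A v, v⟫ := by
  refine (hpos v).lt_of_ne fun h => hv (hinj ?_)
  have := norm_sq_le_of_symm_nonneg hA hpos le_rfl v
  rw [← h, mul_zero] at this
  simpa using this

/-- The derivative of a gradient field is symmetric. -/
lemma inner_fderiv_symm [CompleteSpace E] {φ : E → ℝ} {N : E → E}
    (hN : ∀ z, HasGradientAt φ (N z) z) {N' : E →L[ℝ] E}
    {z : E} (hz : HasFDerivAt N N' z) (u v : E) : ⟪N' u, v⟫ = ⟪u, N' v⟫ := by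
  let B : E →L[ℝ] E →L[ℝ] ℝ := innerSL ℝ
  have h1 : HasFDerivAt (fun y => InnerProductSpace.toDual ℝ E (N y)) (B.comp N') z :=
    B.hasFDerivAt.comp z hz
  -- Symmetry needs the second derivative at the single point `z` only, so the lemma applies to
  -- gradients that are merely Lipschitz, at each of their points of differentiability.
  have := second_derivative_symmetric (𝕜 := ℝ) (fun y => (hN y).hasFDerivAt) h1 u v
  rw [real_inner_comm (N' v)]
  exact this

end Operators

/-! ### Lipschitz bounds from almost everywhere derivative bounds. -/

section AELipschitz

open MeasureTheory

/-- A Lipschitz function on an interval is controlled by an a.e. bound of its derivative. -/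
lemma abs_sub_le_of_ae_hasDerivAt {u : ℝ → ℝ} {K : NNReal} {C : ℝ}
    (hu : LipschitzOnWith K u (Set.uIcc 0 1))
    (h : ∀ᵐ t : ℝ, t ∈ Set.Icc (0 : ℝ) 1 → ∃ c, HasDerivAt u c t ∧ |c| ≤ C) :
    |u 1 - u 0| ≤ C := by
  rw [← hu.absolutelyContinuousOnInterval.integral_deriv_eq_sub, ← Real.norm_eq_abs]
  have := intervalIntegral.norm_integral_le_of_norm_le_const_ae (a := 0) (b := 1) (C := C)
    (f := deriv u) (by
      filter_upwards [h] with t ht hmem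
      rw [Set.uIoc_of_le zero_le_one] at hmem
      obtain ⟨c, hc, hC⟩ := ht ⟨hmem.1.le, hmem.2⟩
      rw [hc.deriv]; exact hC)
  simpa using this

variable {E : Type*} [NormedAddCommGroup E] [InnerProductSpace ℝ E] [FiniteDimensional ℝ E]
  [MeasurableSpace E] [BorelSpace E]

/-- A property valid almost everywhere holds, for almost every translation of a line, almost
everywhere on the translated line. -/
lemma ae_ae_translated_line {p : E → Prop} (hp : ∀ᵐ x : E, p x) (x v : E) :
    ∀ᵐ w : E, ∀ᵐ t : ℝ, p (x + w + t • v) := by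
  obtain ⟨N, hN, hNm, hN0⟩ := exists_measurable_superset_of_null (ae_iff.1 hp)
  have hmeas : MeasurableSet {q : E × ℝ | x + q.1 + q.2 • v ∉ N} := by
    refine MeasurableSet.compl (?_ : MeasurableSet ((fun q : E × ℝ => x + q.1 + q.2 • v) ⁻¹' N))
    exact hNm.preimage (by fun_prop)
  -- For each fixed `t` the map in `w` is a translation and preserves null sets; Fubini then
  -- exchanges the quantifiers. The measurable superset `N` is what makes Fubini applicable.
  have h1 : ∀ᵐ t : ℝ, ∀ᵐ w : E, x + w + t • v ∉ N := by
    refine ae_of_all _ fun t => ?_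
    have : (fun w : E => x + w + t • v) = fun w => w + (x + t • v) := by ext1 w; abel
    rw [ae_iff]
    simp only [not_not]
    change volume ((fun w : E => x + w + t • v) ⁻¹' N) = 0
    rw [this, measure_preimage_add_right, hN0]
  have h2 := (Measure.ae_ae_comm (μ := (volume : Measure E)) (ν := (volume : Measure ℝ))
    (p := fun w t => x + w + t • v ∉ N) hmeas).2 h1
  filter_upwards [h2] with w hw
  filter_upwards [hw] with t ht
  by_contra hc
  exact ht (hN hc)

/-- A Lipschitz function on an open convex set whose derivative is bounded by `C` almost
everywhere is `C`-Lipschitz. -/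
lemma abs_sub_le_of_ae_fderiv_bound {s : Set E} (hs : IsOpen s) (hconv : Convex ℝ s)
    {ψ : E → ℝ} {K : NNReal} (hK : LipschitzOnWith K ψ s) {C : ℝ}
    (h : ∀ᵐ x : E, x ∈ s → ∃ ψ' : E →L[ℝ] ℝ, HasFDerivAt ψ ψ' x ∧ ‖ψ'‖ ≤ C)
    {x y : E} (hx : x ∈ s) (hy : y ∈ s) : |ψ y - ψ x| ≤ C * ‖y - x‖ := by
  set v := y - x with hv
  have hae := ae_ae_translated_line h x v
  have hgood : ∀ w : E, x + w ∈ s → y + w ∈ s →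
      (∀ᵐ t : ℝ, x + w + t • v ∈ s → ∃ ψ' : E →L[ℝ] ℝ, HasFDerivAt ψ ψ' (x + w + t • v) ∧
        ‖ψ'‖ ≤ C) → |ψ (y + w) - ψ (x + w)| ≤ C * ‖v‖ := by
    intro w hxw hyw hw
    have hseg : ∀ t ∈ Set.Icc (0 : ℝ) 1, x + w + t • v ∈ s := by
      intro t ht
      have := hconv.add_smul_sub_mem hxw hyw ht
      rwa [add_sub_add_right_eq_sub] at this
    have hlip : LipschitzOnWith (K * ‖v‖₊) (fun t : ℝ => ψ (x + w + t • v)) (Set.uIcc 0 1) := by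
      rw [Set.uIcc_of_le zero_le_one]
      refine hK.comp (f := fun t : ℝ => x + w + t • v) ?_ hseg
      refine LipschitzWith.lipschitzOnWith (LipschitzWith.of_dist_le_mul fun a b => ?_)
      rw [dist_add_left, dist_eq_norm, ← sub_smul, norm_smul, Real.dist_eq, coe_nnnorm,
        Real.norm_eq_abs, mul_comm]
    have := abs_sub_le_of_ae_hasDerivAt (C := C * ‖v‖) hlip (by
      filter_upwards [hw] with t ht hmem
      obtain ⟨ψ', h1, h2⟩ := ht (hseg t hmem)
      refine ⟨ψ' v, ?_, (ψ'.le_opNorm v).trans (by gcongr)⟩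
      have hl : HasDerivAt (fun t : ℝ => x + w + t • v) v t := by
        simpa using ((hasDerivAt_id t).smul_const v).const_add (x + w)
      exact h1.comp_hasDerivAt t hl)
    have e : x + w + v = y + w := by rw [hv]; abel
    simpa [e] using this
  have hcont : ∀ z ∈ s, Tendsto (fun w => ψ (z + w)) (𝓝 0) (𝓝 (ψ z)) := by
    intro z hz
    have h1 := (hK.continuousOn.continuousAt (hs.mem_nhds hz)).tendsto
    have h2 : Tendsto (fun w : E => z + w) (𝓝 0) (𝓝 z) := by
      simpa using (continuous_const.add continuous_id).tendsto (0 : E) (f := fun w : E => z + w)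
    exact h1.comp h2
  have hmem : ∀ z ∈ s, ∀ᶠ w in 𝓝 (0 : E), z + w ∈ s := by
    intro z hz
    have h2 : Tendsto (fun w : E => z + w) (𝓝 0) (𝓝 z) := by
      simpa using (continuous_const.add continuous_id).tendsto (0 : E) (f := fun w : E => z + w)
    exact h2 (hs.mem_nhds hz)
  -- The segment from `x` to `y` may lie in the exceptional null set. Good translations have full
  -- measure, hence are dense, and letting `w` tend to zero through them recovers the original
  -- segment.
  have hfreq : ∃ᶠ w in 𝓝 (0 : E), |ψ (y + w) - ψ (x + w)| ≤ C * ‖v‖ := by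
    have h1 : ∃ᶠ w in 𝓝 (0 : E), ∀ᵐ t : ℝ, x + w + t • v ∈ s →
        ∃ ψ' : E →L[ℝ] ℝ, HasFDerivAt ψ ψ' (x + w + t • v) ∧ ‖ψ'‖ ≤ C :=
      mem_closure_iff_frequently.1 (Measure.dense_of_ae hae 0)
    refine (h1.and_eventually ((hmem x hx).and (hmem y hy))).mono ?_
    rintro w ⟨h1, h2, h3⟩
    exact hgood w h2 h3 h1
  exact le_of_tendsto_of_frequently ((hcont y hy).sub (hcont x hx)).abs hfreq

end AELipschitz

/-! ### The proximal mapping and the Moreau envelope. -/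

section Prox

open RealInnerProductSpace

set_option linter.unusedSectionVars false

variable {E : Type*} [NormedAddCommGroup E] [InnerProductSpace ℝ E]
  {g : E → EReal} {γ : ℝ}

lemma ProperLscConvex.coe_toReal (hg : ProperLscConvex g) {x : E} (h : g x ≠ ⊤) :
    ((g x).toReal : EReal) = g x := EReal.coe_toReal h (hg.ne_bot x)

lemma ProperLscConvex.segment_le (hg : ProperLscConvex g) {u v : E} {a b t : ℝ}
    (hu : g u ≤ a) (hv : g v ≤ b) (h0 : 0 ≤ t) (h1 : t ≤ 1) :
    g (u + t • (v - u)) ≤ ((a + t * (b - a) : ℝ) : EReal) := by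
  have := hg.convex.add_smul_sub_mem (x := (u, a)) (y := (v, b)) hu hv ⟨h0, h1⟩
  simpa using this

/-- This is what makes the proximal objective coercive. Lower semicontinuity gives `g > a - 1` on a
ball of radius `r`; a drop of at most one over the distance `r / 2` limits, by convexity, the rate
of decrease along the whole ray to `2 / r`. -/
lemma ProperLscConvex.exists_lower_bound (hg : ProperLscConvex g) {x₀ : E} {a : ℝ}
    (ha : g x₀ = a) : ∃ M : ℝ, 0 ≤ M ∧ ∀ u, ((a - 1 - M * ‖u - x₀‖ : ℝ) : EReal) ≤ g u := by
  have h1 : ((a - 1 : ℝ) : EReal) < g x₀ := by rw [ha]; exact_mod_cast sub_one_lt a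
  obtain ⟨r, hr, hball⟩ := Metric.eventually_nhds_iff.1 (hg.lsc x₀ _ h1)
  refine ⟨2 / r, by positivity, fun u => ?_⟩
  by_cases hu : g u = ⊤
  · rw [hu]; exact le_top
  rw [← hg.coe_toReal hu]
  set b := (g u).toReal with hb
  have hub : g u ≤ b := (hg.coe_toReal hu).ge
  refine EReal.coe_le_coe_iff.2 ?_
  rcases lt_or_ge ‖u - x₀‖ r with hs | hs
  · have h2 := hball (y := u) (by rwa [dist_eq_norm])
    replace h2 : ((a - 1 : ℝ) : EReal) < g u := h2
    rw [← hg.coe_toReal hu] at h2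
    have h3 : a - 1 < b := EReal.coe_lt_coe_iff.1 h2
    have : 0 ≤ 2 / r * ‖u - x₀‖ := by positivity
    linarith
  · have hs0 : 0 < ‖u - x₀‖ := hr.trans_le hs
    set t := r / 2 / ‖u - x₀‖ with ht
    have ht0 : 0 < t := by positivity
    have ht1 : t ≤ 1 := by rw [ht, div_le_one hs0]; linarith
    have h2 := hball (y := x₀ + t • (u - x₀)) (by
      rw [dist_eq_norm, add_sub_cancel_left, norm_smul, Real.norm_eq_abs, abs_of_pos ht0, ht,
        div_mul_cancel₀ _ hs0.ne']
      linarith)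
    replace h2 : ((a - 1 : ℝ) : EReal) < g (x₀ + t • (u - x₀)) := h2
    have h3 := h2.trans_le (hg.segment_le ha.le hub ht0.le ht1)
    have h4 : a - 1 < a + t * (b - a) := EReal.coe_lt_coe_iff.1 h3
    have h5 : -1 / t ≤ b - a := by rw [div_le_iff₀ ht0]; linarith
    have h6 : -1 / t = - (2 / r * ‖u - x₀‖) := by rw [ht]; field_simp
    linarith

lemma ProperLscConvex.lowerSemicontinuous_proxObj (hg : ProperLscConvex g) (x : E) :
    LowerSemicontinuous (proxObj γ g x) := by
  refine LowerSemicontinuous.add' hg.lsc ?_ ?_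
  · exact (continuous_coe_real_ereal.comp (by fun_prop)).lowerSemicontinuous
  · intro u
    exact EReal.continuousAt_add (Or.inr (EReal.coe_ne_bot _)) (Or.inr (EReal.coe_ne_top _))

lemma proxObj_le_of_le {x u : E} {b : ℝ} (h : g u ≤ b) :
    proxObj γ g x u ≤ ((b + ‖u - x‖ ^ 2 / (2 * γ) : ℝ) : EReal) := by
  rw [EReal.coe_add]; exact add_le_add_left h _

lemma le_proxObj_of_le {x u : E} {b : ℝ} (h : (b : EReal) ≤ g u) :
    ((b + ‖u - x‖ ^ 2 / (2 * γ) : ℝ) : EReal) ≤ proxObj γ g x u := by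
  rw [EReal.coe_add]; exact add_le_add_left h _

lemma ProperLscConvex.exists_minimizer [FiniteDimensional ℝ E] (hg : ProperLscConvex g)
    (hγ : 0 < γ) (x : E) : ∃ u, ∀ v, proxObj γ g x u ≤ proxObj γ g x v := by
  obtain ⟨x₀, hx₀⟩ := hg.exists_ne_top
  set a := (g x₀).toReal
  have ha : g x₀ = a := (hg.coe_toReal hx₀).symm
  obtain ⟨M, hM0, hM⟩ := hg.exists_lower_bound ha
  set c := a + ‖x₀ - x‖ ^ 2 / (2 * γ) with hc
  -- Outside this radius the first entry makes the quadratic term exceed `(M + 1) * ‖v - x‖`, and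
  -- the second makes the spare `‖v - x‖` exceed the gap to the value `c` attained at `x₀`. The
  -- third places `x₀` in the ball.
  set ρ := max (max (2 * γ * (M + 1)) (c - (a - 1) + M * ‖x - x₀‖)) ‖x₀ - x‖ with hρ
  have hx₀mem : x₀ ∈ Metric.closedBall x ρ := by
    rw [Metric.mem_closedBall, dist_eq_norm]; exact le_max_right _ _
  obtain ⟨u, -, hu⟩ := ((hg.lowerSemicontinuous_proxObj (γ := γ) x).lowerSemicontinuousOn
    (Metric.closedBall x ρ)).exists_isMinOn ⟨x₀, hx₀mem⟩ (isCompact_closedBall x ρ)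
  refine ⟨u, fun v => ?_⟩
  by_cases hv : v ∈ Metric.closedBall x ρ
  · exact hu hv
  rw [Metric.mem_closedBall, dist_eq_norm, not_le] at hv
  refine (hu hx₀mem).trans ((proxObj_le_of_le ha.le).trans (le_trans ?_ (le_proxObj_of_le (hM v))))
  refine EReal.coe_le_coe_iff.2 ?_
  have h1 : 2 * γ * (M + 1) < ‖v - x‖ := ((le_max_left _ _).trans (le_max_left _ _)).trans_lt hv
  have h2 : c - (a - 1) + M * ‖x - x₀‖ < ‖v - x‖ :=
    ((le_max_right _ _).trans (le_max_left _ _)).trans_lt hv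
  have h3 : ‖v - x₀‖ ≤ ‖v - x‖ + ‖x - x₀‖ := norm_sub_le_norm_sub_add_norm_sub _ _ _
  have h4 : (M + 1) * ‖v - x‖ ≤ ‖v - x‖ ^ 2 / (2 * γ) := by
    rw [le_div_iff₀ (by positivity)]
    nlinarith [norm_nonneg (v - x)]
  have h5 := mul_le_mul_of_nonneg_left h3 hM0
  linarith

variable [FiniteDimensional ℝ E]

lemma prox_spec (hg : ProperLscConvex g) (hγ : 0 < γ) (x v : E) :
    proxObj γ g x (prox γ g x) ≤ proxObj γ g x v :=
  Classical.epsilon_spec (p := fun u => ∀ v, proxObj γ g x u ≤ proxObj γ g x v)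
    (hg.exists_minimizer hγ x) v

lemma apply_prox_ne_top (hg : ProperLscConvex g) (hγ : 0 < γ) (x : E) :
    g (prox γ g x) ≠ ⊤ := by
  intro h
  obtain ⟨x₀, hx₀⟩ := hg.exists_ne_top
  have h1 := (prox_spec hg hγ x x₀).trans (proxObj_le_of_le (hg.coe_toReal hx₀).ge)
  rw [proxObj, h, EReal.top_add_coe, top_le_iff] at h1
  exact EReal.coe_ne_top _ h1

lemma proxObj_prox (hg : ProperLscConvex g) (hγ : 0 < γ) (x : E) :
    proxObj γ g x (prox γ g x) =
      (((g (prox γ g x)).toReal + ‖prox γ g x - x‖ ^ 2 / (2 * γ) : ℝ) : EReal) := by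
  rw [EReal.coe_add, hg.coe_toReal (apply_prox_ne_top hg hγ x), proxObj]

lemma moreau_toReal (hg : ProperLscConvex g) (hγ : 0 < γ) (x : E) :
    (moreau γ g x).toReal = (g (prox γ g x)).toReal + ‖prox γ g x - x‖ ^ 2 / (2 * γ) := by
  have : moreau γ g x = proxObj γ g x (prox γ g x) :=
    le_antisymm (iInf_le _ _) (le_iInf fun v => prox_spec hg hγ x v)
  rw [this, proxObj_prox hg hγ, EReal.toReal_coe]

lemma moreau_toReal_le (hg : ProperLscConvex g) (hγ : 0 < γ) (x : E) {v : E} {b : ℝ}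
    (h : g v ≤ b) : (moreau γ g x).toReal ≤ b + ‖v - x‖ ^ 2 / (2 * γ) := by
  rw [moreau_toReal hg hγ, ← EReal.coe_le_coe_iff, ← proxObj_prox hg hγ]
  exact (prox_spec hg hγ x v).trans (proxObj_le_of_le h)

/-- The variational inequality that characterizes the proximal point. -/
lemma prox_variational (hg : ProperLscConvex g) (hγ : 0 < γ) (x : E) {v : E} {b : ℝ}
    (h : g v ≤ b) :
    ⟪x - prox γ g x, v - prox γ g x⟫ ≤ γ * (b - (g (prox γ g x)).toReal) := by
  set p := prox γ g x with hp
  set a := (g p).toReal with ha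
  have hpa : g p ≤ a := (hg.coe_toReal (apply_prox_ne_top hg hγ x)).ge
  -- Minimality of `p` against `p + t • (v - p)`, divided by `t / γ`; the right-hand side disappears
  -- as `t` tends to zero.
  have key : ∀ t : ℝ, 0 < t → t ≤ 1 →
      ⟪x - p, v - p⟫ - γ * (b - a) ≤ t * (‖v - p‖ ^ 2 / 2) := by
    intro t h0 h1
    have h2 := moreau_toReal_le hg hγ x (hg.segment_le hpa h h0.le h1)
    rw [moreau_toReal hg hγ, ← hp, ← ha] at h2
    have h3 : p + t • (v - p) - x = (p - x) + t • (v - p) := by abel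
    have h4 : ⟪p - x, v - p⟫ = - ⟪x - p, v - p⟫ := by rw [← inner_neg_left, neg_sub]
    rw [h3, norm_add_sq_real, inner_smul_right, norm_smul, h4, mul_pow, Real.norm_eq_abs,
      sq_abs] at h2
    have h5 : 0 ≤ t * (b - a) +
        (2 * (t * -⟪x - p, v - p⟫) + t ^ 2 * ‖v - p‖ ^ 2) / (2 * γ) := by
      rw [show (‖p - x‖ ^ 2 + 2 * (t * -⟪x - p, v - p⟫) + t ^ 2 * ‖v - p‖ ^ 2) / (2 * γ) =
        ‖p - x‖ ^ 2 / (2 * γ) +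
          (2 * (t * -⟪x - p, v - p⟫) + t ^ 2 * ‖v - p‖ ^ 2) / (2 * γ) by ring] at h2
      linarith
    have h6 : t * (b - a) + (2 * (t * -⟪x - p, v - p⟫) + t ^ 2 * ‖v - p‖ ^ 2) / (2 * γ) =
        t / γ * (γ * (b - a) - ⟪x - p, v - p⟫ + t * (‖v - p‖ ^ 2 / 2)) := by
      field_simp; ring
    rw [h6] at h5
    have := nonneg_of_mul_nonneg_right h5 (by positivity)
    linarith
  have hlim : Tendsto (fun t : ℝ => t * (‖v - p‖ ^ 2 / 2)) (𝓝[>] 0) (𝓝 0) := by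
    have : Tendsto (fun t : ℝ => t * (‖v - p‖ ^ 2 / 2)) (𝓝 0) (𝓝 (0 * (‖v - p‖ ^ 2 / 2))) :=
      (continuous_id.mul continuous_const).tendsto 0
    rw [zero_mul] at this
    exact this.mono_left nhdsWithin_le_nhds
  have := ge_of_tendsto hlim (by
    filter_upwards [Ioc_mem_nhdsGT (zero_lt_one (α := ℝ))] with t ht using key t ht.1 ht.2)
  linarith

/-- Firm nonexpansiveness: in the sum of the variational inequalities at `x` and at `y`, each tested
with the other proximal point, the values of `g` cancel. -/
lemma norm_prox_sub_sq_le (hg : ProperLscConvex g) (hγ : 0 < γ) (x y : E) :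
    ‖prox γ g x - prox γ g y‖ ^ 2 ≤ ⟪x - y, prox γ g x - prox γ g y⟫ := by
  have h1 := prox_variational hg hγ x (hg.coe_toReal (apply_prox_ne_top hg hγ y)).ge
  have h2 := prox_variational hg hγ y (hg.coe_toReal (apply_prox_ne_top hg hγ x)).ge
  set p := prox γ g x
  set q := prox γ g y
  have e : ⟪x - y, p - q⟫ = ‖p - q‖ ^ 2 - (⟪x - p, q - p⟫ + ⟪y - q, p - q⟫) := by
    rw [← real_inner_self_eq_norm_sq]
    simp only [inner_sub_left, inner_sub_right]
    ring
  nlinarith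

lemma lipschitzWith_prox (hg : ProperLscConvex g) (hγ : 0 < γ) :
    LipschitzWith 1 (prox γ g) := by
  refine LipschitzWith.of_dist_le_mul fun x y => ?_
  rw [dist_eq_norm, dist_eq_norm, NNReal.coe_one, one_mul]
  have h1 := norm_prox_sub_sq_le hg hγ x y
  have h2 := real_inner_le_norm (x - y) (prox γ g x - prox γ g y)
  by_contra! h
  nlinarith [norm_nonneg (x - y)]

/-- Two-sided quadratic bound for the linearization error of the Moreau envelope. -/
lemma abs_moreau_sub_le (hg : ProperLscConvex g) (hγ : 0 < γ) (x y : E) :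
    |(moreau γ g y).toReal - (moreau γ g x).toReal - ⟪γ⁻¹ • (x - prox γ g x), y - x⟫| ≤
      ‖y - x‖ ^ 2 / (2 * γ) := by
  have h1 := moreau_toReal_le hg hγ y (hg.coe_toReal (apply_prox_ne_top hg hγ x)).ge
  have h2 := moreau_toReal_le hg hγ x (hg.coe_toReal (apply_prox_ne_top hg hγ y)).ge
  have h3 := moreau_toReal hg hγ x
  have h4 := moreau_toReal hg hγ y
  have h5 := norm_prox_sub_sq_le hg hγ x y
  have h6 := (real_inner_le_norm (x - y) (prox γ g x - prox γ g y)).trans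
    (mul_le_mul_of_nonneg_left (by simpa [dist_eq_norm] using
      (lipschitzWith_prox hg hγ).dist_le_mul x y) (norm_nonneg _))
  set p := prox γ g x
  set q := prox γ g y
  -- Using `p` as competitor at `y` yields the upper estimate, and using `q` as competitor at `x`
  -- the lower one. The latter leaves the extra term `γ⁻¹ * ⟪x - y, p - q⟫`, which nonexpansiveness
  -- bounds by twice the allowed error.
  have e1 : ‖p - y‖ ^ 2 / (2 * γ) = ‖p - x‖ ^ 2 / (2 * γ) + ⟪γ⁻¹ • (x - p), y - x⟫ +
      ‖y - x‖ ^ 2 / (2 * γ) := by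
    have : p - y = -((x - p) + (y - x)) := by abel
    rw [this, norm_neg, norm_add_sq_real, norm_sub_rev x p, inner_smul_left, conj_trivial]
    field_simp
  have e2 : ‖q - x‖ ^ 2 / (2 * γ) = ‖q - y‖ ^ 2 / (2 * γ) - ⟪γ⁻¹ • (x - p), y - x⟫ -
      ‖y - x‖ ^ 2 / (2 * γ) + γ⁻¹ * ⟪x - y, p - q⟫ := by
    have : q - x = -((y - q) - (y - x)) := by abel
    rw [this, norm_neg, norm_sub_sq_real, norm_sub_rev y q, inner_smul_left, conj_trivial]
    have e3 : ⟪y - q, y - x⟫ = ⟪x - p, y - x⟫ + ‖y - x‖ ^ 2 - ⟪x - y, p - q⟫ := by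
      have h7 : y - q = (x - p) + (y - x) + (p - q) := by abel
      have h8 : ⟪p - q, y - x⟫ = -⟪x - y, p - q⟫ := by
        rw [real_inner_comm, ← inner_neg_left, neg_sub]
      rw [h7, inner_add_left, inner_add_left, h8, real_inner_self_eq_norm_sq]
      ring
    rw [e3]
    field_simp
    ring
  rw [abs_le]
  constructor
  · have : γ⁻¹ * ⟪x - y, p - q⟫ ≤ 2 * (‖y - x‖ ^ 2 / (2 * γ)) := by
      rw [norm_sub_rev x y] at h6
      have := mul_le_mul_of_nonneg_left h6 (inv_pos.2 hγ).le
      calc _ ≤ _ := this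
        _ = _ := by field_simp
    linarith
  · linarith

variable [CompleteSpace E]

lemma hasGradientAt_moreau (hg : ProperLscConvex g) (hγ : 0 < γ) (x : E) :
    HasGradientAt (fun z => (moreau γ g z).toReal) (γ⁻¹ • (x - prox γ g x)) x := by
  rw [hasGradientAt_iff_isLittleO]
  refine IsBigO.trans_isLittleO (g := fun y => ‖y - x‖ ^ 2) ?_ ?_
  · refine IsBigO.of_bound (1 / (2 * γ)) (Eventually.of_forall fun y => ?_)
    refine (abs_moreau_sub_le hg hγ x y).trans (le_of_eq ?_)
    rw [norm_pow, norm_norm]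
    ring
  · exact isLittleO_norm_pow_id (by norm_num) |>.comp_tendsto
      (k := fun y : E => y - x) (by
        have : Tendsto (fun y : E => y - x) (𝓝 x) (𝓝 (x - x)) :=
          (continuous_id.sub continuous_const).tendsto x
        rwa [sub_self] at this)

lemma norm_fderiv_prox_le (hg : ProperLscConvex g) (hγ : 0 < γ) (x : E) :
    ‖fderiv ℝ (prox γ g) x‖ ≤ 1 := by
  simpa using norm_fderiv_le_of_lipschitz ℝ (lipschitzWith_prox hg hγ) (x₀ := x)

/-- The map `γ⁻¹ (id - prox)` is a gradient field, so its derivative is symmetric, and with it that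
of the proximal mapping. -/
lemma inner_fderiv_prox_symm (hg : ProperLscConvex g) (hγ : 0 < γ) {z : E}
    (hz : DifferentiableAt ℝ (prox γ g) z) (u v : E) :
    ⟪fderiv ℝ (prox γ g) z u, v⟫ = ⟪u, fderiv ℝ (prox γ g) z v⟫ := by
  have h := inner_fderiv_symm (hasGradientAt_moreau hg hγ)
    (((hasFDerivAt_id z).sub hz.hasFDerivAt).const_smul γ⁻¹) u v
  simp only [smul_apply, sub_apply, inner_smul_left,
    inner_smul_right, conj_trivial, inner_sub_left, inner_sub_right] at h
  have := mul_left_cancel₀ (inv_pos.2 hγ).ne' h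
  simp only [ContinuousLinearMap.id_apply] at this
  linarith

/-- A closed convex condition that holds at all derivatives near `z` holds on the generalized
Jacobian. -/
lemma clarke_subset_of_eventually {G : E → E} {z : E} {S : Set (E →L[ℝ] E)} (hS : IsClosed S)
    (hconv : Convex ℝ S) (h : ∀ᶠ y in 𝓝 z, DifferentiableAt ℝ G y → fderiv ℝ G y ∈ S) :
    clarke G z ⊆ S := by
  refine convexHull_min ?_ hconv
  rintro P ⟨y, hy, hyz, hP⟩
  exact hS.mem_of_tendsto hP ((hyz.eventually h).mono fun k hk => hk (hy k))

lemma norm_le_one_of_mem_clarke (hg : ProperLscConvex g) (hγ : 0 < γ) {z : E} {P : E →L[ℝ] E}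
    (hP : P ∈ clarke (prox γ g) z) : ‖P‖ ≤ 1 := by
  have h : clarke (prox γ g) z ⊆ Metric.closedBall (0 : E →L[ℝ] E) 1 := by
    refine clarke_subset_of_eventually Metric.isClosed_closedBall (convex_closedBall _ _)
      (Eventually.of_forall fun y _ => ?_)
    rw [mem_closedBall_zero_iff]
    exact norm_fderiv_prox_le hg hγ y
  exact mem_closedBall_zero_iff.1 (h hP)

lemma symm_of_mem_clarke (hg : ProperLscConvex g) (hγ : 0 < γ) {z : E} {P : E →L[ℝ] E}
    (hP : P ∈ clarke (prox γ g) z) (u v : E) : ⟪P u, v⟫ = ⟪u, P v⟫ := by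
  refine clarke_subset_of_eventually (S := {P : E →L[ℝ] E | ⟪P u, v⟫ = ⟪u, P v⟫}) ?_ ?_
    (Eventually.of_forall fun y hy => inner_fderiv_prox_symm hg hγ hy u v) hP
  · exact isClosed_eq (by fun_prop) (by fun_prop)
  · intro A hA B hB a b _ _ _
    simp only [Set.mem_ofPred_eq] at hA hB ⊢
    simp [inner_add_left, inner_add_right, inner_smul_left, inner_smul_right, hA, hB]

end Prox

/-! ### The forward-backward envelope: gradient and generalized Hessian. -/

section Envelope

set_option linter.unusedSectionVars false

open RealInnerProductSpace

variable {E : Type*} [NormedAddCommGroup E] [InnerProductSpace ℝ E] [CompleteSpace E]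
  {f : E → ℝ} {g : E → EReal} {γ μ : ℝ} {L : NNReal}

lemma SmoothClass.hasGradientAt (hf : SmoothClass μ L f) (x : E) :
    HasGradientAt f (gradient f x) x :=
  (hf.contDiff.differentiable (by norm_num) x).hasGradientAt

lemma SmoothClass.contDiff_gradient (hf : SmoothClass μ L f) : ContDiff ℝ 1 (gradient f) := by
  have h : ContDiff ℝ 1 (fderiv ℝ f) := hf.contDiff.fderiv_right (by norm_num)
  let B : StrongDual ℝ E →L[ℝ] E :=
    (InnerProductSpace.toDual ℝ E).symm.toContinuousLinearEquiv.toContinuousLinearMap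
  exact B.contDiff.comp h

lemma SmoothClass.hasFDerivAt_gradient (hf : SmoothClass μ L f) (x : E) :
    HasFDerivAt (gradient f) (hess f x) x :=
  (hf.contDiff_gradient.differentiable (by norm_num) x).hasFDerivAt

lemma SmoothClass.continuous_hess (hf : SmoothClass μ L f) : Continuous (hess f) :=
  hf.contDiff_gradient.continuous_fderiv (by norm_num)

lemma SmoothClass.inner_hess_symm (hf : SmoothClass μ L f) (x u v : E) :
    ⟪hess f x u, v⟫ = ⟪u, hess f x v⟫ :=
  inner_fderiv_symm hf.hasGradientAt (hf.hasFDerivAt_gradient x) u v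

lemma SmoothClass.norm_hess_le (hf : SmoothClass μ L f) (x : E) : ‖hess f x‖ ≤ L :=
  norm_fderiv_le_of_lipschitz ℝ hf.lipschitz_gradient

lemma SmoothClass.inner_hess_nonneg (hf : SmoothClass μ L f) (x v : E) :
    0 ≤ ⟪hess f x v, v⟫ := by
  have hconv : ConvexOn ℝ Set.univ f := by
    refine UniformConvexOn.convexOn hf.strongConvex fun r => ?_
    have := hf.modulus_nonneg
    simp only [Pi.zero_apply]
    positivity
  have hl : ∀ t : ℝ, HasDerivAt (fun t : ℝ => x + t • v) v t := fun t => by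
    simpa using ((hasDerivAt_id t).smul_const v).const_add x
  have hd : ∀ t : ℝ, HasDerivAt (fun t : ℝ => f (x + t • v)) ⟪gradient f (x + t • v), v⟫ t := by
    intro t
    exact (hf.hasGradientAt _).hasFDerivAt.comp_hasDerivAt t (hl t)
  have hc : ConvexOn ℝ Set.univ (fun t : ℝ => f (x + t • v)) := by
    refine ⟨convex_univ, fun s _ t _ a b ha hb hab => ?_⟩
    have := hconv.2 (Set.mem_univ (x + s • v)) (Set.mem_univ (x + t • v)) ha hb hab
    have e : a • (x + s • v) + b • (x + t • v) = x + (a • s + b • t) • v := by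
      have : x = (a + b) • x := by rw [hab, one_smul]
      conv_rhs => rw [this]
      simp only [smul_eq_mul]
      module
    rwa [e] at this
  -- The restriction of `f` to a line is convex, so its derivative is monotone; the Hessian form is
  -- the derivative of that at zero.
  have hm : Monotone (fun t : ℝ => ⟪gradient f (x + t • v), v⟫) := by
    have := hc.monotoneOn_deriv (fun t _ => (hd t).differentiableAt)
    rw [show deriv (fun t : ℝ => f (x + t • v)) = fun t => ⟪gradient f (x + t • v), v⟫ from
      funext fun t => (hd t).deriv] at this
    exact monotoneOn_univ.1 this
  have hd2 : HasDerivAt (fun t : ℝ => ⟪gradient f (x + t • v), v⟫) ⟪hess f x v, v⟫ 0 := by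
    have h1 : HasDerivAt (fun t : ℝ => gradient f (x + t • v)) (hess f x v) 0 := by
      have h2 := hf.hasFDerivAt_gradient (x + (0 : ℝ) • v)
      have h3 := h2.comp_hasDerivAt 0 (hl 0)
      rw [zero_smul, add_zero] at h3
      exact h3
    simpa using h1.inner ℝ (hasDerivAt_const (0 : ℝ) v)
  rw [← hd2.deriv]
  exact hm.deriv_nonneg

/-- The Jacobian of the forward step. -/
noncomputable def fwdJac (f : E → ℝ) (γ : ℝ) (x : E) : E →L[ℝ] E := 1 - γ • hess f x

lemma fwdJac_apply (x v : E) : fwdJac f γ x v = v - γ • hess f x v := rfl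

lemma SmoothClass.continuous_fwdJac (hf : SmoothClass μ L f) : Continuous (fwdJac f γ) :=
  continuous_const.sub (hf.continuous_hess.const_smul γ)

lemma SmoothClass.inner_fwdJac_symm (hf : SmoothClass μ L f) (x u v : E) :
    ⟪fwdJac f γ x u, v⟫ = ⟪u, fwdJac f γ x v⟫ := by
  simp only [fwdJac_apply, inner_sub_left, inner_sub_right, inner_smul_left, inner_smul_right,
    conj_trivial, hf.inner_hess_symm]

lemma SmoothClass.inner_fwdJac_ge (hf : SmoothClass μ L f) (hγ : 0 < γ) (x v : E) :
    (1 - γ * L) * ‖v‖ ^ 2 ≤ ⟪fwdJac f γ x v, v⟫ := by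
  rw [fwdJac_apply, inner_sub_left, inner_smul_left, conj_trivial, real_inner_self_eq_norm_sq]
  have h1 := real_inner_le_norm (hess f x v) v
  have h2 := (hess f x).le_of_opNorm_le (hf.norm_hess_le x) v
  have h3 : ⟪hess f x v, v⟫ ≤ L * ‖v‖ ^ 2 := by nlinarith [norm_nonneg v]
  nlinarith

/-- Cocoercivity of the Hessian with `γ L < 1` gives `γ ‖∇²f v‖² ≤ ⟪∇²f v, v⟫`, which absorbs the
square term of `‖Q v‖²`. -/
lemma SmoothClass.norm_fwdJac_sq_le (hf : SmoothClass μ L f) (hγ : 0 < γ) (hγL : γ * L < 1)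
    (x v : E) : ‖fwdJac f γ x v‖ ^ 2 ≤ ⟪fwdJac f γ x v, v⟫ := by
  have h := norm_sq_le_of_symm_nonneg (hf.inner_hess_symm x) (hf.inner_hess_nonneg x)
    (hf.norm_hess_le x) v
  have h0 := hf.inner_hess_nonneg x v
  rw [fwdJac_apply, norm_sub_sq_real, inner_sub_left, inner_smul_left, inner_smul_right,
    conj_trivial, real_inner_self_eq_norm_sq, norm_smul, mul_pow, Real.norm_eq_abs, sq_abs,
    real_inner_comm]
  have h1 : γ * ‖hess f x v‖ ^ 2 ≤ ⟪hess f x v, v⟫ := by nlinarith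
  rw [real_inner_comm] at h1 ⊢
  nlinarith

lemma SmoothClass.norm_fwdJac_apply_le (hf : SmoothClass μ L f) (hγ : 0 < γ) (hγL : γ * L < 1)
    (x v : E) : ‖fwdJac f γ x v‖ ≤ ‖v‖ := by
  have h1 := hf.norm_fwdJac_sq_le hγ hγL x v
  have h2 := real_inner_le_norm (fwdJac f γ x v) v
  by_contra! h
  nlinarith [norm_nonneg v]

lemma SmoothClass.norm_le_fwdJac_apply (hf : SmoothClass μ L f) (hγ : 0 < γ)
    (x v : E) : (1 - γ * L) * ‖v‖ ≤ ‖fwdJac f γ x v‖ := by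
  have h1 := hf.inner_fwdJac_ge hγ x v
  have h2 := real_inner_le_norm (fwdJac f γ x v) v
  rcases (norm_nonneg v).eq_or_lt with h | h
  · rw [← h]; simp
  · by_contra! h3
    nlinarith

/-- The operator `γ⁻¹ Q (1 - P Q)`, for `Q` the Jacobian of the forward step. -/
noncomputable def newtonOp (f : E → ℝ) (γ : ℝ) (x : E) (P : E →L[ℝ] E) : E →L[ℝ] E :=
  γ⁻¹ • (fwdJac f γ x * (1 - P * fwdJac f γ x))

lemma newtonOp_apply (x v : E) (P : E →L[ℝ] E) :
    newtonOp f γ x P v = γ⁻¹ • fwdJac f γ x (v - P (fwdJac f γ x v)) := rfl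

lemma mem_approxHess_iff {x : E} {H : E →L[ℝ] E} : H ∈ approxHess f g γ x ↔
    ∃ P ∈ clarke (prox γ g) (x - γ • gradient f x), H = newtonOp f γ x P := Iff.rfl

lemma SmoothClass.inner_newtonOp (hf : SmoothClass μ L f) (x u v : E) (P : E →L[ℝ] E) :
    ⟪newtonOp f γ x P u, v⟫ =
      γ⁻¹ * (⟪fwdJac f γ x u, v⟫ - ⟪P (fwdJac f γ x u), fwdJac f γ x v⟫) := by
  rw [newtonOp_apply, inner_smul_left, conj_trivial, map_sub, inner_sub_left,
    hf.inner_fwdJac_symm x (P _)]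

lemma SmoothClass.newtonOp_symm (hf : SmoothClass μ L f) {P : E →L[ℝ] E}
    (hP : ∀ u v, ⟪P u, v⟫ = ⟪u, P v⟫) (x u v : E) :
    ⟪newtonOp f γ x P u, v⟫ = ⟪u, newtonOp f γ x P v⟫ := by
  rw [real_inner_comm (newtonOp f γ x P v), hf.inner_newtonOp, hf.inner_newtonOp, hP,
    hf.inner_fwdJac_symm, real_inner_comm u, real_inner_comm (fwdJac f γ x u)]

/-- The chain is `⟪P Q v, Q v⟫ ≤ ‖Q v‖² ≤ ⟪Q v, v⟫`; no sign of `P` enters, only its norm. -/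
lemma SmoothClass.newtonOp_nonneg (hf : SmoothClass μ L f) (hγ : 0 < γ) (hγL : γ * L < 1)
    {P : E →L[ℝ] E} (hP : ‖P‖ ≤ 1) (x v : E) : 0 ≤ ⟪newtonOp f γ x P v, v⟫ := by
  rw [hf.inner_newtonOp]
  refine mul_nonneg (inv_pos.2 hγ).le ?_
  have h1 := hf.norm_fwdJac_sq_le hγ hγL x v
  have h2 := real_inner_le_norm (P (fwdJac f γ x v)) (fwdJac f γ x v)
  have h3 := P.le_of_opNorm_le hP (fwdJac f γ x v)
  nlinarith [norm_nonneg (fwdJac f γ x v)]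

lemma SmoothClass.norm_newtonOp_apply_le (hf : SmoothClass μ L f) (hγ : 0 < γ)
    (hγL : γ * L < 1) {P : E →L[ℝ] E} (hP : ‖P‖ ≤ 1) (x v : E) :
    ‖newtonOp f γ x P v‖ ≤ 2 * γ⁻¹ * ‖v‖ := by
  rw [newtonOp_apply, norm_smul, Real.norm_eq_abs, abs_of_pos (inv_pos.2 hγ)]
  have h1 := hf.norm_fwdJac_apply_le hγ hγL x (v - P (fwdJac f γ x v))
  have h2 := norm_sub_le v (P (fwdJac f γ x v))
  have h3 := P.le_of_opNorm_le hP (fwdJac f γ x v)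
  have h4 := hf.norm_fwdJac_apply_le hγ hγL x v
  have h5 : ‖fwdJac f γ x (v - P (fwdJac f γ x v))‖ ≤ 2 * ‖v‖ := by linarith
  calc _ ≤ γ⁻¹ * (2 * ‖v‖) := by gcongr
    _ = _ := by ring

/-- The residual of the forward-backward step. -/
noncomputable def fbRes (f : E → ℝ) (g : E → EReal) (γ : ℝ) (x : E) : E :=
  x - prox γ g (x - γ • gradient f x)

variable [FiniteDimensional ℝ E]

lemma SmoothClass.hasGradientAt_fbe (hf : SmoothClass μ L f) (hg : ProperLscConvex g)
    (hγ : 0 < γ) (x : E) :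
    HasGradientAt (fbe f g γ) (γ⁻¹ • fwdJac f γ x (fbRes f g γ x)) x := by
  have h1 := (hf.hasGradientAt x).hasFDerivAt
  have h2 := hf.hasFDerivAt_gradient x
  have h3 := (hasGradientAt_moreau hg hγ (x - γ • gradient f x)).hasFDerivAt
  have h4 : HasFDerivAt (fun x => x - γ • gradient f x) (fwdJac f γ x) x :=
    (hasFDerivAt_id x).sub (h2.const_smul γ)
  have h5 := (h1.sub ((h2.norm_sq).const_mul (γ / 2))).add (h3.comp x h4)
  rw [hasGradientAt_iff_hasFDerivAt]
  refine h5.congr_fderiv ?_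
  ext v
  set a := gradient f x with ha
  set p := prox γ g (x - γ • a) with hp
  -- The terms `f` and `-γ/2 ‖∇f‖²` together contribute `Q a`, and the chain rule contributes `Q`
  -- applied to the gradient of the Moreau envelope. This splitting of the residual merges the two.
  have e : γ⁻¹ • fbRes f g γ x = a + γ⁻¹ • (x - γ • a - p) := by
    rw [fbRes, ← ha, ← hp, sub_right_comm, smul_sub γ⁻¹ (x - p), smul_smul,
      inv_mul_cancel₀ hγ.ne', one_smul]
    abel
  rw [← map_smul, e]
  simp only [InnerProductSpace.toDual_apply_apply, add_apply, sub_apply, smul_apply,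
    ContinuousLinearMap.comp_apply, innerSL_apply_apply, hf.inner_fwdJac_symm, inner_add_left]
  simp only [fwdJac_apply, inner_sub_right, inner_smul_right, nsmul_eq_mul, smul_eq_mul]
  push_cast
  ring

lemma SmoothClass.gradient_fbe (hf : SmoothClass μ L f) (hg : ProperLscConvex g)
    (hγ : 0 < γ) (x : E) :
    gradient (fbe f g γ) x = γ⁻¹ • fwdJac f γ x (fbRes f g γ x) :=
  (hf.hasGradientAt_fbe hg hγ x).gradient

lemma SmoothClass.norm_fwdStep_sub_le (hf : SmoothClass μ L f) (hγ : 0 < γ) (hγL : γ * L < 1)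
    (x y : E) : ‖(x - γ • gradient f x) - (y - γ • gradient f y)‖ ≤ 2 * ‖x - y‖ := by
  have h1 : ‖gradient f x - gradient f y‖ ≤ L * ‖x - y‖ := by
    simpa [dist_eq_norm] using hf.lipschitz_gradient.dist_le_mul x y
  have e : (x - γ • gradient f x) - (y - γ • gradient f y) =
      (x - y) - γ • (gradient f x - gradient f y) := by rw [smul_sub]; abel
  rw [e]
  refine (norm_sub_le _ _).trans ?_
  rw [norm_smul, Real.norm_eq_abs, abs_of_pos hγ]
  nlinarith [norm_nonneg (x - y)]

lemma SmoothClass.norm_fbRes_sub_le (hf : SmoothClass μ L f) (hg : ProperLscConvex g)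
    (hγ : 0 < γ) (hγL : γ * L < 1) (x y : E) :
    ‖fbRes f g γ x - fbRes f g γ y‖ ≤ 3 * ‖x - y‖ := by
  have h1 := hf.norm_fwdStep_sub_le hγ hγL x y
  have h2 : ‖prox γ g (x - γ • gradient f x) - prox γ g (y - γ • gradient f y)‖ ≤
      ‖(x - γ • gradient f x) - (y - γ • gradient f y)‖ := by
    simpa [dist_eq_norm] using (lipschitzWith_prox hg hγ).dist_le_mul
      (x - γ • gradient f x) (y - γ • gradient f y)
  have e : fbRes f g γ x - fbRes f g γ y = (x - y) -
      (prox γ g (x - γ • gradient f x) - prox γ g (y - γ • gradient f y)) := by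
    rw [fbRes, fbRes]; abel
  rw [e]
  refine (norm_sub_le _ _).trans ?_
  linarith

lemma SmoothClass.continuous_gradient_fbe (hf : SmoothClass μ L f) (hg : ProperLscConvex g)
    (hγ : 0 < γ) : Continuous (gradient (fbe f g γ)) := by
  rw [show gradient (fbe f g γ) = fun x => γ⁻¹ • fwdJac f γ x (fbRes f g γ x) from
    funext fun x => hf.gradient_fbe hg hγ x]
  have h1 : Continuous (fbRes f g γ) := continuous_id.sub ((lipschitzWith_prox hg hγ).continuous.comp
    (continuous_id.sub (hf.lipschitz_gradient.continuous.const_smul γ)))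
  exact (hf.continuous_fwdJac.clm_apply h1).const_smul _

end Envelope

/-! ### The trapezoidal rule for semismooth gradients. -/

section Trapezoid

set_option linter.unusedSectionVars false

open RealInnerProductSpace MeasureTheory

variable {E : Type*} [NormedAddCommGroup E] [InnerProductSpace ℝ E] [CompleteSpace E]
  [FiniteDimensional ℝ E]

/-- The trapezoidal rule has an error `o(‖z - a‖²)` for functions whose gradient is Lipschitz and
semismooth at `a`. -/
lemma eventually_trapezoid {φ : E → ℝ} {N : E → E} (hN : ∀ z, HasGradientAt φ (N z) z)
    {K : NNReal} (hK : LipschitzWith K N) {a : E}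
    (h : ∀ ε > 0, ∀ᶠ z in 𝓝 a, DifferentiableAt ℝ N z →
      ‖N z - N a - fderiv ℝ N z (z - a)‖ ≤ ε * ‖z - a‖) {ε : ℝ} (hε : 0 < ε) :
    ∀ᶠ z in 𝓝 a, |φ z - φ a - 1 / 2 * ⟪N z + N a, z - a⟫| ≤ ε * ‖z - a‖ ^ 2 := by
  obtain ⟨r, hr, hball⟩ := Metric.eventually_nhds_iff.1 (h ε hε)
  refine Metric.eventually_nhds_iff.2 ⟨r / 2, by positivity, fun z hz => ?_⟩
  rw [dist_eq_norm] at hz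
  rcases (norm_nonneg (z - a)).eq_or_lt with h0 | h0
  · have : z = a := by rw [← sub_eq_zero, ← norm_eq_zero, ← h0]
    simp [this]
  -- The open ball of radius `ρ` contains `z` and stays inside the radius `r`. The factor 2 is
  -- compensated by the 1/2 in the gradient of `ψ`.
  set ρ := 2 * ‖z - a‖ with hρ
  have hρ0 : 0 < ρ := by positivity
  set s := Metric.ball a ρ with hs
  let ψ : E → ℝ := fun y => 1 / 2 * ⟪N y + N a, y - a⟫ - φ y
  set m := ‖N a‖ + K * ρ with hm
  have hNl : ∀ y w, ‖N y - N w‖ ≤ K * ‖y - w‖ := fun y w => by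
    simpa [dist_eq_norm] using hK.dist_le_mul y w
  have hsd : ∀ y ∈ s, ‖y - a‖ ≤ ρ := fun y hy => by
    rw [← dist_eq_norm]; exact (Metric.mem_ball.1 hy).le
  have hNm : ∀ y ∈ s, ‖N y‖ ≤ m := by
    intro y hy
    have h1 : N y = N a + (N y - N a) := by abel
    rw [h1]
    refine (norm_add_le _ _).trans ?_
    have := (hNl y a).trans (mul_le_mul_of_nonneg_left (hsd y hy) K.coe_nonneg)
    linarith
  have hψl : LipschitzOnWith (Real.toNNReal (1 / 2 * (K * ρ + 2 * m) + m)) ψ s := by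
    refine LipschitzOnWith.of_dist_le_mul fun y hy w hw => ?_
    rw [Real.coe_toNNReal _ (by positivity), Real.dist_eq, dist_eq_norm]
    have h1 : |φ y - φ w| ≤ m * ‖y - w‖ :=
      (convex_ball a ρ).norm_image_sub_le_of_norm_hasFDerivWithin_le
        (fun x _ => (hN x).hasFDerivAt.hasFDerivWithinAt)
        (fun x hx => by simpa using hNm x hx) hw hy
    have h2 : ⟪N y + N a, y - a⟫ - ⟪N w + N a, w - a⟫ =
        ⟪N y - N w, y - a⟫ + ⟪N w + N a, y - w⟫ := by
      simp only [inner_add_left, inner_sub_left, inner_sub_right]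
      ring
    have h3 : |⟪N y - N w, y - a⟫| ≤ K * ‖y - w‖ * ρ :=
      (abs_real_inner_le_norm _ _).trans (mul_le_mul (hNl y w) (hsd y hy) (norm_nonneg _)
        (by positivity))
    have h4 : |⟪N w + N a, y - w⟫| ≤ (m + m) * ‖y - w‖ := by
      refine (abs_real_inner_le_norm _ _).trans ?_
      gcongr
      exact (norm_add_le _ _).trans (add_le_add (hNm w hw) (hNm a (Metric.mem_ball_self hρ0)))
    have h5 : ψ y - ψ w = 1 / 2 * (⟪N y - N w, y - a⟫ + ⟪N w + N a, y - w⟫) - (φ y - φ w) := by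
      rw [← h2]; simp only [ψ]; ring
    rw [h5]
    rw [abs_le] at h1 h3 h4 ⊢
    constructor <;> linarith [h1.1, h1.2, h3.1, h3.2, h4.1, h4.2]
  borelize E
  -- By Rademacher `N` is differentiable almost everywhere. There, symmetry of its derivative makes
  -- the gradient of `ψ` equal to half of `N'(y)(y - a) - (N y - N a)`, exactly the quantity that
  -- semismoothness makes small.
  have hae : ∀ᵐ y : E, y ∈ s → ∃ ψ' : E →L[ℝ] ℝ, HasFDerivAt ψ ψ' y ∧ ‖ψ'‖ ≤ ε * ‖z - a‖ := by
    filter_upwards [hK.ae_differentiableAt (μ := volume)] with y hy hys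
    have hyr : dist y a < r := (Metric.mem_ball.1 hys).trans (by linarith)
    have hb := hball hyr hy
    refine ⟨InnerProductSpace.toDual ℝ E ((1 / 2 : ℝ) • (fderiv ℝ N y (y - a) - (N y - N a))),
      ?_, ?_⟩
    · have h1 := ((hy.hasFDerivAt.add_const (N a)).inner ℝ ((hasFDerivAt_id y).sub_const a)
        ).const_mul (1 / 2)
      refine (h1.sub (hN y).hasFDerivAt).congr_fderiv ?_
      ext v
      have h2 : ⟪fderiv ℝ N y v, y - a⟫ = ⟪fderiv ℝ N y (y - a), v⟫ :=
        (inner_fderiv_symm hN hy.hasFDerivAt _ _).trans (real_inner_comm _ _)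
      change 1 / 2 * (⟪N y + N a, v⟫ + ⟪fderiv ℝ N y v, y - a⟫) - ⟪N y, v⟫ =
        ⟪(1 / 2 : ℝ) • (fderiv ℝ N y (y - a) - (N y - N a)), v⟫
      rw [h2, inner_smul_left, inner_sub_left, inner_sub_left, inner_add_left, conj_trivial]
      ring
    · rw [LinearIsometryEquiv.norm_map, norm_smul, norm_sub_rev, Real.norm_eq_abs,
        abs_of_pos (by norm_num : (0 : ℝ) < 1 / 2)]
      have h6 := mul_le_mul_of_nonneg_left (hsd y hys) hε.le
      linarith
  have hfin := abs_sub_le_of_ae_fderiv_bound Metric.isOpen_ball (convex_ball a ρ) hψl hae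
    (Metric.mem_ball_self hρ0) (show z ∈ s by rw [hs, Metric.mem_ball, dist_eq_norm]; linarith)
  have e : ψ z - ψ a = -(φ z - φ a - 1 / 2 * ⟪N z + N a, z - a⟫) := by
    simp only [ψ, sub_self, inner_zero_right]; ring
  rw [e, abs_neg] at hfin
  calc _ ≤ _ := hfin
    _ = _ := by ring

end Trapezoid

/-! ### Newton linearization and trapezoidal rule at a zero of the residual. -/

section Local

set_option linter.unusedSectionVars false

open RealInnerProductSpace

variable {E : Type*} [NormedAddCommGroup E] [InnerProductSpace ℝ E] [CompleteSpace E]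
  {f : E → ℝ} {g : E → EReal} {γ μ : ℝ} {L : NNReal} {xs : E}

/-- The Hessian sits at the moving point `x`, as in the definition of semismoothness; its continuity
pays for the change from `xs`. -/
lemma SmoothClass.eventually_hess (hf : SmoothClass μ L f) (xs : E) {ε : ℝ} (hε : 0 < ε) :
    ∀ᶠ x in 𝓝 xs, ‖gradient f x - gradient f xs - hess f x (x - xs)‖ ≤ ε * ‖x - xs‖ := by
  have h1 := (hf.hasFDerivAt_gradient xs).isLittleO.def (half_pos hε)
  have h2 := Metric.tendsto_nhds.1 (hf.continuous_hess.tendsto xs) (ε / 2) (half_pos hε)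
  filter_upwards [h1, h2] with x hx1 hx2
  rw [dist_eq_norm] at hx2
  have h3 := (hess f x - hess f xs).le_of_opNorm_le hx2.le (x - xs)
  have e : gradient f x - gradient f xs - hess f x (x - xs) =
      (gradient f x - gradient f xs - hess f xs (x - xs)) - (hess f x - hess f xs) (x - xs) := by
    rw [sub_apply]; abel
  rw [e]
  refine (norm_sub_le _ _).trans ?_
  linarith

lemma SmoothClass.eventually_hess_of_lipschitz (hf : SmoothClass μ L f)
    (hl : LipschitzAround (hess f) xs) : ∃ C, 0 ≤ C ∧
    ∀ᶠ x in 𝓝 xs, ‖gradient f x - gradient f xs - hess f x (x - xs)‖ ≤ C * ‖x - xs‖ ^ 2 := by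
  obtain ⟨K, U, hU, hK⟩ := hl
  obtain ⟨r, hr, hball⟩ := Metric.mem_nhds_iff.1 hU
  refine ⟨K, K.coe_nonneg, ?_⟩
  filter_upwards [Metric.ball_mem_nhds xs hr] with x hx
  have hseg : segment ℝ xs x ⊆ U :=
    ((convex_ball xs r).segment_subset (Metric.mem_ball_self hr) hx).trans hball
  have := (convex_segment xs x).norm_image_sub_le_of_norm_hasFDerivWithin_le'
    (C := K * ‖x - xs‖) (φ := hess f x)
    (fun y _ => (hf.hasFDerivAt_gradient y).hasFDerivWithinAt)
    (fun y hy => by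
      have h1 := hK.dist_le_mul y (hseg hy) x (hseg (right_mem_segment ℝ xs x))
      rw [dist_eq_norm, dist_eq_norm] at h1
      refine h1.trans ?_
      gcongr
      have := norm_sub_le_of_mem_segment (segment_symm ℝ xs x ▸ hy)
      rwa [norm_sub_rev xs x] at this)
    (left_mem_segment ℝ xs x) (right_mem_segment ℝ xs x)
  calc _ ≤ _ := this
    _ = _ := by ring

lemma SmoothClass.continuous_fwdStep (hf : SmoothClass μ L f) :
    Continuous fun x => x - γ • gradient f x :=
  continuous_id.sub (hf.lipschitz_gradient.continuous.const_smul γ)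

/-- Error of the generalized Newton linearization of the envelope gradient at a zero of the
residual. -/
lemma SmoothClass.norm_gradient_sub_newtonOp_le (hf : SmoothClass μ L f)
    (hγ : 0 < γ) (hγL : γ * L < 1) (hxs : fbRes f g γ xs = 0) (x : E) {P : E →L[ℝ] E}
    (hP : ‖P‖ ≤ 1) :
    ‖γ⁻¹ • fwdJac f γ x (fbRes f g γ x) - newtonOp f γ x P (x - xs)‖ ≤
      γ⁻¹ * ‖prox γ g (x - γ • gradient f x) +
        P ((xs - γ • gradient f xs) - (x - γ • gradient f x)) -
        prox γ g (xs - γ • gradient f xs)‖ +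
      ‖gradient f x - gradient f xs - hess f x (x - xs)‖ := by
  set A := prox γ g (x - γ • gradient f x) +
        P ((xs - γ • gradient f xs) - (x - γ • gradient f x)) -
        prox γ g (xs - γ • gradient f xs) with hA
  set B := gradient f x - gradient f xs - hess f x (x - xs) with hB
  -- Since `xs` is the proximal point of its own forward step, the error splits into the
  -- linearization error `A` of the proximal mapping and `B` of `∇f`. The outer factor `Q(x)` is
  -- never differentiated, because the residual vanishes at `xs`.
  have e1 : fbRes f g γ x - (x - xs - P (fwdJac f γ x (x - xs))) = -A + γ • P B := by
    have h1 : prox γ g (xs - γ • gradient f xs) = xs := (sub_eq_zero.1 hxs).symm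
    rw [hA, h1, fbRes, hB, fwdJac_apply]
    simp only [map_sub, map_smul, smul_sub]
    abel
  rw [newtonOp_apply, ← smul_sub, ← map_sub, e1, norm_smul, Real.norm_eq_abs,
    abs_of_pos (inv_pos.2 hγ)]
  have h2 := hf.norm_fwdJac_apply_le hγ hγL x (-A + γ • P B)
  have h3 := norm_add_le (-A) (γ • P B)
  have h4 := P.le_of_opNorm_le hP B
  rw [norm_neg, norm_smul, Real.norm_eq_abs, abs_of_pos hγ] at h3
  have h5 : ‖fwdJac f γ x (-A + γ • P B)‖ ≤ ‖A‖ + γ * ‖B‖ := by nlinarith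
  calc _ ≤ γ⁻¹ * (‖A‖ + γ * ‖B‖) := by gcongr
    _ = _ := by field_simp

variable [FiniteDimensional ℝ E]

lemma SmoothClass.eventually_newton (hf : SmoothClass μ L f) (hg : ProperLscConvex g)
    (hγ : 0 < γ) (hγL : γ * L < 1) (hxs : fbRes f g γ xs = 0)
    (hsemi : SemismoothAt (prox γ g) (xs - γ • gradient f xs)) {ε : ℝ} (hε : 0 < ε) :
    ∀ᶠ x in 𝓝 xs, ∀ H ∈ approxHess f g γ x,
      ‖gradient (fbe f g γ) x - H (x - xs)‖ ≤ ε * ‖x - xs‖ := by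
  have h1 := (hf.continuous_fwdStep (γ := γ)).tendsto xs
    |>.eventually (hsemi.2 (γ * ε / 4) (by positivity))
  filter_upwards [h1, hf.eventually_hess xs (half_pos hε)] with x hx1 hx2 H hH
  obtain ⟨P, hP, rfl⟩ := mem_approxHess_iff.1 hH
  rw [hf.gradient_fbe hg hγ]
  refine (hf.norm_gradient_sub_newtonOp_le hγ hγL hxs x
    (norm_le_one_of_mem_clarke hg hγ hP)).trans ?_
  have h2 := mul_le_mul_of_nonneg_left (hx1 P hP) (inv_pos.2 hγ).le
  have h3 := mul_le_mul_of_nonneg_left (hf.norm_fwdStep_sub_le hγ hγL x xs)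
    (by positivity : (0 : ℝ) ≤ ε / 4)
  have h4 : γ⁻¹ * (γ * ε / 4 * ‖(x - γ • gradient f x) - (xs - γ • gradient f xs)‖) =
      ε / 4 * ‖(x - γ • gradient f x) - (xs - γ • gradient f xs)‖ := by field_simp
  linarith

lemma SmoothClass.eventually_newton_strong (hf : SmoothClass μ L f) (hg : ProperLscConvex g)
    (hγ : 0 < γ) (hγL : γ * L < 1) (hxs : fbRes f g γ xs = 0)
    (hsemi : StronglySemismoothAt (prox γ g) (xs - γ • gradient f xs))
    (hl : LipschitzAround (hess f) xs) :
    ∃ C, 0 ≤ C ∧ ∀ᶠ x in 𝓝 xs, ∀ H ∈ approxHess f g γ x,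
      ‖gradient (fbe f g γ) x - H (x - xs)‖ ≤ C * ‖x - xs‖ ^ 2 := by
  obtain ⟨-, C₁, hC₁⟩ := hsemi
  obtain ⟨C₂, hC₂0, hC₂⟩ := hf.eventually_hess_of_lipschitz hl
  refine ⟨γ⁻¹ * (|C₁| * 4) + C₂, by positivity, ?_⟩
  have h1 := (hf.continuous_fwdStep (γ := γ)).tendsto xs |>.eventually hC₁
  filter_upwards [h1, hC₂] with x hx1 hx2 H hH
  obtain ⟨P, hP, rfl⟩ := mem_approxHess_iff.1 hH
  rw [hf.gradient_fbe hg hγ]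
  refine (hf.norm_gradient_sub_newtonOp_le hγ hγL hxs x
    (norm_le_one_of_mem_clarke hg hγ hP)).trans ?_
  have h3 : ‖(x - γ • gradient f x) - (xs - γ • gradient f xs)‖ ^ 2 ≤ 4 * ‖x - xs‖ ^ 2 := by
    calc _ ≤ (2 * ‖x - xs‖) ^ 2 := by gcongr; exact hf.norm_fwdStep_sub_le hγ hγL x xs
      _ = _ := by ring
  have h2 : γ⁻¹ * ‖prox γ g (x - γ • gradient f x) +
        P ((xs - γ • gradient f xs) - (x - γ • gradient f x)) -
        prox γ g (xs - γ • gradient f xs)‖ ≤ γ⁻¹ * (|C₁| * (4 * ‖x - xs‖ ^ 2)) := by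
    gcongr
    refine (hx1 P hP).trans ?_
    gcongr
    exact le_abs_self _
  calc _ ≤ _ := add_le_add h2 hx2
    _ = _ := by ring

/-- The trapezoidal rule for the forward-backward envelope. -/
lemma SmoothClass.eventually_fbe_trapezoid (hf : SmoothClass μ L f) (hg : ProperLscConvex g)
    (hγ : 0 < γ) (hγL : γ * L < 1) (hxs : fbRes f g γ xs = 0)
    (hsemi : SemismoothAt (prox γ g) (xs - γ • gradient f xs)) {ε : ℝ} (hε : 0 < ε) :
    ∀ᶠ x in 𝓝 xs, |fbe f g γ x - fbe f g γ xs - 1 / 2 * ⟪gradient (fbe f g γ) x, x - xs⟫| ≤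
      ε * ‖x - xs‖ ^ 2 := by
  -- The rule is applied to `f` and to the Moreau envelope separately: the gradient of `fbe`
  -- contains `∇²f`, which is only continuous, and need not be Lipschitz.
  have hT1 := eventually_trapezoid hf.hasGradientAt hf.lipschitz_gradient (a := xs)
    (fun ε hε => (hf.eventually_hess xs hε).mono fun x hx _ => hx)
    (by positivity : (0 : ℝ) < ε / 10)
  set zs := xs - γ • gradient f xs with hzs
  have hNl : LipschitzWith (Real.toNNReal (2 * γ⁻¹)) fun z => γ⁻¹ • (z - prox γ g z) := by
    refine LipschitzWith.of_dist_le_mul fun y w => ?_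
    have h1 : ‖prox γ g y - prox γ g w‖ ≤ ‖y - w‖ := by
      simpa [dist_eq_norm] using (lipschitzWith_prox hg hγ).dist_le_mul y w
    rw [Real.coe_toNNReal _ (by positivity), dist_eq_norm, dist_eq_norm, ← smul_sub, norm_smul,
      Real.norm_eq_abs, abs_of_pos (inv_pos.2 hγ)]
    have h2 : ‖y - prox γ g y - (w - prox γ g w)‖ ≤ 2 * ‖y - w‖ := by
      rw [show y - prox γ g y - (w - prox γ g w) = (y - w) - (prox γ g y - prox γ g w) by abel]
      exact (norm_sub_le _ _).trans (by linarith)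
    calc _ ≤ γ⁻¹ * (2 * ‖y - w‖) := by gcongr
      _ = _ := by ring
  have hT2 := eventually_trapezoid (hasGradientAt_moreau hg hγ) hNl (a := zs) (by
    intro ε' hε'
    filter_upwards [hsemi.2 (γ * ε') (by positivity)] with z hz hd
    have hd' : DifferentiableAt ℝ (prox γ g) z := by
      have h1 : prox γ g = fun z => z - γ • (γ⁻¹ • (z - prox γ g z)) := by
        ext1 z; rw [smul_smul, mul_inv_cancel₀ hγ.ne', one_smul]; abel
      rw [h1]
      exact differentiableAt_id.sub (hd.const_smul γ)
    have hmem : fderiv ℝ (prox γ g) z ∈ clarke (prox γ g) z :=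
      subset_convexHull ℝ _ ⟨fun _ => z, fun _ => hd', tendsto_const_nhds, tendsto_const_nhds⟩
    have h2 : fderiv ℝ (fun z => γ⁻¹ • (z - prox γ g z)) z (z - zs) =
        γ⁻¹ • ((z - zs) - fderiv ℝ (prox γ g) z (z - zs)) := by
      have h4 : HasFDerivAt (fun z => γ⁻¹ • (z - prox γ g z))
          (γ⁻¹ • (ContinuousLinearMap.id ℝ E - fderiv ℝ (prox γ g) z)) z :=
        ((hasFDerivAt_id z).sub hd'.hasFDerivAt).const_smul γ⁻¹
      rw [h4.fderiv]
      rfl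
    rw [h2, ← smul_sub, ← smul_sub, norm_smul, Real.norm_eq_abs, abs_of_pos (inv_pos.2 hγ)]
    have h3 : z - prox γ g z - (zs - prox γ g zs) - (z - zs - fderiv ℝ (prox γ g) z (z - zs)) =
        -(prox γ g z + fderiv ℝ (prox γ g) z (zs - z) - prox γ g zs) := by
      rw [← neg_sub z zs, map_neg]; abel
    rw [h3, norm_neg]
    calc _ ≤ γ⁻¹ * (γ * ε' * ‖z - zs‖) := by gcongr; exact hz _ hmem
      _ = _ := by field_simp) (by positivity : (0 : ℝ) < ε / 10)
  have hT2' := (hf.continuous_fwdStep (γ := γ)).tendsto xs |>.eventually hT2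
  filter_upwards [hT1, hT2', hf.eventually_hess xs (by positivity : (0 : ℝ) < ε / 10)]
    with x hx1 hx2 hx3
  have h1 : ‖fbRes f g γ x‖ ≤ 3 * ‖x - xs‖ := by
    simpa [hxs] using hf.norm_fbRes_sub_le hg hγ hγL x xs
  have h2 := (abs_real_inner_le_norm (fbRes f g γ x)
    (gradient f x - gradient f xs - hess f x (x - xs))).trans
    (mul_le_mul h1 hx3 (norm_nonneg _) (by positivity))
  have h3 : ‖(x - γ • gradient f x) - zs‖ ^ 2 ≤ 4 * ‖x - xs‖ ^ 2 := by
    calc _ ≤ (2 * ‖x - xs‖) ^ 2 := by gcongr; exact hf.norm_fwdStep_sub_le hγ hγL x xs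
      _ = _ := by ring
  have h4 := mul_le_mul_of_nonneg_left h3 (by positivity : (0 : ℝ) ≤ ε / 10)
  -- The error for the envelope is the sum of the two trapezoidal errors, minus half the product of
  -- the residual, of size `O(‖x - xs‖)`, with the linearization error of `∇f`, of size `o(‖x -
  -- xs‖)`.
  have e : fbe f g γ x - fbe f g γ xs - 1 / 2 * ⟪gradient (fbe f g γ) x, x - xs⟫ =
      (f x - f xs - 1 / 2 * ⟪gradient f x + gradient f xs, x - xs⟫) +
      ((moreau γ g (x - γ • gradient f x)).toReal - (moreau γ g zs).toReal - 1 / 2 *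
        ⟪γ⁻¹ • (x - γ • gradient f x - prox γ g (x - γ • gradient f x)) +
          γ⁻¹ • (zs - prox γ g zs), (x - γ • gradient f x) - zs⟫) -
      1 / 2 * ⟪fbRes f g γ x, gradient f x - gradient f xs - hess f x (x - xs)⟫ := by
    have e1 : γ⁻¹ • (x - γ • gradient f x - prox γ g (x - γ • gradient f x)) =
        γ⁻¹ • fbRes f g γ x - gradient f x := by
      rw [fbRes, sub_right_comm, smul_sub γ⁻¹ (x - _), smul_smul, inv_mul_cancel₀ hγ.ne', one_smul]
    have e2 : γ⁻¹ • (zs - prox γ g zs) = - gradient f xs := by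
      have h5 : prox γ g zs = xs := (sub_eq_zero.1 hxs).symm
      rw [h5, hzs, sub_sub_cancel_left, smul_neg, smul_smul, inv_mul_cancel₀ hγ.ne', one_smul]
    have e3 : (x - γ • gradient f x) - zs = (x - xs) - γ • (gradient f x - gradient f xs) := by
      rw [hzs, smul_sub]; abel
    rw [e1, e2, e3, hf.gradient_fbe hg hγ, fbe, fbe, ← hzs, inner_smul_left, hf.inner_fwdJac_symm,
      fwdJac_apply]
    simp only [← real_inner_self_eq_norm_sq, inner_add_left, inner_sub_left,
      inner_sub_right, inner_smul_left, inner_smul_right, inner_neg_left, conj_trivial]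
    rw [real_inner_comm (gradient f x) (gradient f xs)]
    field_simp
    ring
  rw [e]
  rw [abs_le] at hx1 hx2 h2 ⊢
  constructor <;> nlinarith [sq_nonneg ‖x - xs‖, hx1.1, hx1.2, hx2.1, hx2.2, h2.1, h2.2]

end Local

/-! ### Uniform positive definiteness near a nonsingular point. -/

section Nonsingular

open RealInnerProductSpace

variable {E : Type*} [NormedAddCommGroup E] [InnerProductSpace ℝ E] [CompleteSpace E]
  [FiniteDimensional ℝ E]
  {f : E → ℝ} {g : E → EReal} {γ μ : ℝ} {L : NNReal} {xs : E}

/-- If all elements of the generalized Hessian at `xs` are nonsingular, the operators built from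
nearby Jacobians of the proximal mapping are uniformly positive definite. -/
lemma SmoothClass.exists_newtonOp_fderiv_ge (hf : SmoothClass μ L f) (hg : ProperLscConvex g)
    (hγ : 0 < γ) (hγL : γ * L < 1) (hns : ∀ V ∈ approxHess f g γ xs, IsUnit V) :
    ∃ c > 0, ∀ᶠ q : E × E in 𝓝 (xs, xs - γ • gradient f xs), DifferentiableAt ℝ (prox γ g) q.2 →
      ∀ v, c * ‖v‖ ^ 2 ≤ ⟪newtonOp f γ q.1 (fderiv ℝ (prox γ g) q.2) v, v⟫ := by
  by_contra! hcon
  -- Failure for every `c` gives unit vectors on which the forms become at most `1 / (k + 1)`. Along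
  -- a subsequence the Jacobians converge to an element of the generalized Jacobian at `xs`, whose
  -- form would be nonpositive at a unit vector. The two components of `q` vary independently,
  -- because Jacobians at `x` are limits from points other than the forward step of `x`.
  have hseq : ∀ k : ℕ, ∃ q : E × E, ∃ w : E,
      dist q (xs, xs - γ • gradient f xs) < 1 / ((k : ℝ) + 1) ∧
      DifferentiableAt ℝ (prox γ g) q.2 ∧ ‖w‖ = 1 ∧
      ⟪newtonOp f γ q.1 (fderiv ℝ (prox γ g) q.2) w, w⟫ < 1 / ((k : ℝ) + 1) := by
    intro k
    have hk : (0 : ℝ) < 1 / ((k : ℝ) + 1) := Nat.one_div_pos_of_nat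
    obtain ⟨q, ⟨hd, v, hv⟩, hq⟩ := ((hcon _ hk).and_eventually (Metric.ball_mem_nhds _ hk)).exists
    have hv0 : v ≠ 0 := by rintro rfl; simp at hv
    have hvn : 0 < ‖v‖ := norm_pos_iff.2 hv0
    refine ⟨q, ‖v‖⁻¹ • v, hq, hd, ?_, ?_⟩
    · rw [norm_smul, norm_inv, norm_norm, inv_mul_cancel₀ hvn.ne']
    · rw [map_smul, inner_smul_left, inner_smul_right, conj_trivial]
      calc _ < ‖v‖⁻¹ * (‖v‖⁻¹ * (1 / ((k : ℝ) + 1) * ‖v‖ ^ 2)) := by gcongr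
        _ = _ := by field_simp
  choose q w hq hd hw hlt using hseq
  have hqlim : Tendsto q atTop (𝓝 (xs, xs - γ • gradient f xs)) :=
    tendsto_iff_dist_tendsto_zero.2 (squeeze_zero (fun _ => dist_nonneg) (fun k => (hq k).le)
      tendsto_one_div_add_atTop_nhds_zero_nat)
  have : ProperSpace (E →L[ℝ] E) := FiniteDimensional.proper ℝ _
  have : ProperSpace E := FiniteDimensional.proper ℝ _
  have hmem : ∀ k, (fderiv ℝ (prox γ g) (q k).2, w k) ∈
      Metric.closedBall (0 : E →L[ℝ] E) 1 ×ˢ Metric.sphere (0 : E) 1 := fun k =>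
    ⟨mem_closedBall_zero_iff.2 (norm_fderiv_prox_le hg hγ _), mem_sphere_zero_iff_norm.2 (hw k)⟩
  obtain ⟨⟨P, u⟩, hPu, φ, hφ, hlim⟩ :=
    ((isCompact_closedBall _ _).prod (isCompact_sphere _ _)).tendsto_subseq hmem
  have hPlim := (continuous_fst.tendsto _).comp hlim
  have hulim := (continuous_snd.tendsto _).comp hlim
  have hqφ := hqlim.comp hφ.tendsto_atTop
  have hPmem : P ∈ clarke (prox γ g) (xs - γ • gradient f xs) :=
    subset_convexHull ℝ _ ⟨fun k => (q (φ k)).2, fun k => hd _,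
      (continuous_snd.tendsto _).comp hqφ, hPlim⟩
  have hu : u ≠ 0 := by
    have := mem_sphere_zero_iff_norm.1 hPu.2
    rintro rfl
    simp at this
  have hpos : 0 < ⟪newtonOp f γ xs P u, u⟫ :=
    inner_pos_of_symm_nonneg (hf.newtonOp_symm (symm_of_mem_clarke hg hγ hPmem) xs)
      (hf.newtonOp_nonneg hγ hγL (norm_le_one_of_mem_clarke hg hγ hPmem) xs)
      (by
        obtain ⟨W, hW⟩ := (hns _ (mem_approxHess_iff.2 ⟨P, hPmem, rfl⟩)).exists_left_inv
        refine Function.LeftInverse.injective (g := W) fun v => ?_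
        change (W * newtonOp f γ xs P) v = v
        rw [hW]; rfl) hu
  have hcont : Continuous fun p : E × (E →L[ℝ] E) × E => ⟪newtonOp f γ p.1 p.2.1 p.2.2, p.2.2⟫ := by
    have hQ : Continuous fun p : E × (E →L[ℝ] E) × E => fwdJac f γ p.1 :=
      hf.continuous_fwdJac.comp continuous_fst
    simp only [newtonOp]
    fun_prop
  have hlim2 := (hcont.tendsto (xs, P, u)).comp
    (((continuous_fst.tendsto _).comp hqφ).prodMk_nhds (hPlim.prodMk_nhds hulim))
  have hle : ⟪newtonOp f γ xs P u, u⟫ ≤ 0 :=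
    le_of_tendsto_of_tendsto' hlim2
      ((tendsto_one_div_add_atTop_nhds_zero_nat (𝕜 := ℝ)).comp hφ.tendsto_atTop)
      fun k => (hlt (φ k)).le
  exact absurd hpos hle.not_gt

/-- Uniform positive definiteness of the approximate generalized Hessian near `xs`. -/
lemma SmoothClass.exists_approxHess_ge (hf : SmoothClass μ L f) (hg : ProperLscConvex g)
    (hγ : 0 < γ) (hγL : γ * L < 1) (hns : ∀ V ∈ approxHess f g γ xs, IsUnit V) :
    ∃ c > 0, ∀ᶠ x in 𝓝 xs, ∀ H ∈ approxHess f g γ x, ∀ v, c * ‖v‖ ^ 2 ≤ ⟪H v, v⟫ := by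
  obtain ⟨c, hc, h⟩ := hf.exists_newtonOp_fderiv_ge hg hγ hγL hns
  refine ⟨c, hc, ?_⟩
  have hcont : Continuous fun x => (x, x - γ • gradient f x) :=
    continuous_id.prodMk hf.continuous_fwdStep
  filter_upwards [(hcont.tendsto xs).eventually h.eventually_nhds] with x hx H hH v
  obtain ⟨P, hP, rfl⟩ := mem_approxHess_iff.1 hH
  have hy : ∀ᶠ y in 𝓝 (x - γ • gradient f x), DifferentiableAt ℝ (prox γ g) y →
      ∀ v, c * ‖v‖ ^ 2 ≤ ⟪newtonOp f γ x (fderiv ℝ (prox γ g) y) v, v⟫ :=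
    (Continuous.prodMk_right x).tendsto _ |>.eventually hx
  -- The form is affine in `P`, so the lower bound defines a closed convex set and passes from
  -- nearby Jacobians to limits and convex combinations.
  have hsub : clarke (prox γ g) (x - γ • gradient f x) ⊆
      {P | c * ‖v‖ ^ 2 ≤ ⟪newtonOp f γ x P v, v⟫} := by
    simp only [hf.inner_newtonOp] at hy ⊢
    refine clarke_subset_of_eventually ?_ ?_ (hy.mono fun y hy hd => hy hd v)
    · exact isClosed_le continuous_const (by fun_prop)
    · intro A hA B hB a b ha hb hab
      simp only [Set.mem_ofPred_eq] at hA hB ⊢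
      have e : γ⁻¹ * (⟪fwdJac f γ x v, v⟫ -
          ⟪(a • A + b • B) (fwdJac f γ x v), fwdJac f γ x v⟫) =
          a * (γ⁻¹ * (⟪fwdJac f γ x v, v⟫ - ⟪A (fwdJac f γ x v), fwdJac f γ x v⟫)) +
          b * (γ⁻¹ * (⟪fwdJac f γ x v, v⟫ - ⟪B (fwdJac f γ x v), fwdJac f γ x v⟫)) := by
        simp only [add_apply, smul_apply, inner_add_left, inner_smul_left, conj_trivial]
        linear_combination (-γ⁻¹ * ⟪fwdJac f γ x v, v⟫) * hab
      rw [e]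
      calc c * ‖v‖ ^ 2 = a * (c * ‖v‖ ^ 2) + b * (c * ‖v‖ ^ 2) := by rw [← add_mul, hab, one_mul]
        _ ≤ _ := by gcongr
  exact hsub hP

end Nonsingular

/-! ### Descent along a run, and stationarity of the accumulation point. -/

section Run

set_option linter.unusedSectionVars false

open RealInnerProductSpace

variable {E : Type*} [NormedAddCommGroup E] [InnerProductSpace ℝ E] [CompleteSpace E]
  [FiniteDimensional ℝ E]
  {f : E → ℝ} {g : E → EReal} {γ μ σ ηbar ζ ρ : ℝ} {L : NNReal} {xs : E}
  {x : ℕ → E} {H : ℕ → E →L[ℝ] E} {d : ℕ → E} {τ : ℕ → ℝ}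

lemma approxHess_symm (hf : SmoothClass μ L f) (hg : ProperLscConvex g) (hγ : 0 < γ) {y : E}
    {V : E →L[ℝ] E} (hV : V ∈ approxHess f g γ y) (u v : E) : ⟪V u, v⟫ = ⟪u, V v⟫ := by
  obtain ⟨P, hP, rfl⟩ := mem_approxHess_iff.1 hV
  exact hf.newtonOp_symm (symm_of_mem_clarke hg hγ hP) y u v

lemma approxHess_nonneg (hf : SmoothClass μ L f) (hg : ProperLscConvex g) (hγ : 0 < γ)
    (hγL : γ * L < 1) {y : E} {V : E →L[ℝ] E} (hV : V ∈ approxHess f g γ y) (v : E) :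
    0 ≤ ⟪V v, v⟫ := by
  obtain ⟨P, hP, rfl⟩ := mem_approxHess_iff.1 hV
  exact hf.newtonOp_nonneg hγ hγL (norm_le_one_of_mem_clarke hg hγ hP) y v

lemma norm_approxHess_apply_le (hf : SmoothClass μ L f) (hg : ProperLscConvex g) (hγ : 0 < γ)
    (hγL : γ * L < 1) {y : E} {V : E →L[ℝ] E} (hV : V ∈ approxHess f g γ y) (v : E) :
    ‖V v‖ ≤ 2 * γ⁻¹ * ‖v‖ := by
  obtain ⟨P, hP, rfl⟩ := mem_approxHess_iff.1 hV
  exact hf.norm_newtonOp_apply_le hγ hγL (norm_le_one_of_mem_clarke hg hγ hP) y v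

/-- The Galerkin identity of CG in terms of the run: an exact formula for the slope in spite of the
inexact solve. -/
lemma IsRun.inner_gradient (hrun : IsRun f g γ σ ηbar ζ ρ x H d τ) (hf : SmoothClass μ L f)
    (hg : ProperLscConvex g) (hγ : 0 < γ) (hγL : γ * L < 1) (hζ : 0 < ζ) (k : ℕ) :
    ⟪gradient (fbe f g γ) (x k), d k⟫ =
      -(⟪H k (d k), d k⟫ + regParam f g γ ζ (x k) * ‖d k‖ ^ 2) := by
  obtain ⟨j, hj⟩ := hrun.dir_cg k
  have hA : ∀ v, (H k + regParam f g γ ζ (x k) • (1 : E →L[ℝ] E)) v =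
      H k v + regParam f g γ ζ (x k) • v := fun v => rfl
  have h := inner_cg_pt (A := H k + regParam f g γ ζ (x k) • (1 : E →L[ℝ] E))
    (b := -gradient (fbe f g γ) (x k)) (by
      intro u v
      rw [hA, hA, inner_add_left, inner_add_right, inner_smul_left, inner_smul_right,
        conj_trivial, approxHess_symm hf hg hγ (hrun.hess_mem k)]) (by
      intro hb v hv
      have h1 := approxHess_nonneg hf hg hγ hγL (hrun.hess_mem k) v
      have h2 : 0 < regParam f g γ ζ (x k) := mul_pos hζ (norm_pos_iff.2 (neg_ne_zero.1 hb))
      rw [hA, inner_add_right, inner_smul_right, real_inner_self_eq_norm_sq, real_inner_comm]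
      have := norm_pos_iff.2 hv
      positivity) j
  rw [← hj, hA, inner_neg_left, inner_add_left, inner_smul_left, conj_trivial,
    real_inner_self_eq_norm_sq] at h
  linarith

lemma IsRun.step_pos (hrun : IsRun f g γ σ ηbar ζ ρ x H d τ) (k : ℕ) : 0 < τ k := by
  obtain ⟨⟨i, hi⟩, -⟩ := (hrun.step_armijo k).1
  rw [hi]; positivity

lemma IsRun.step_le_one (hrun : IsRun f g γ σ ηbar ζ ρ x H d τ) (k : ℕ) : τ k ≤ 1 := by
  obtain ⟨⟨i, hi⟩, -⟩ := (hrun.step_armijo k).1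
  rw [hi]; exact pow_le_one₀ (by norm_num) (by norm_num)

lemma IsRun.fbe_succ_le (hrun : IsRun f g γ σ ηbar ζ ρ x H d τ) (k : ℕ) :
    fbe f g γ (x (k + 1)) ≤
      fbe f g γ (x k) + σ * τ k * ⟪gradient (fbe f g γ) (x k), d k⟫ := by
  rw [hrun.update k]; exact (hrun.step_armijo k).1.2

lemma regParam_nonneg (hζ : 0 < ζ) (y : E) : 0 ≤ regParam f g γ ζ y :=
  mul_nonneg hζ.le (norm_nonneg _)

lemma IsRun.antitone_fbe (hrun : IsRun f g γ σ ηbar ζ ρ x H d τ) (hf : SmoothClass μ L f)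
    (hg : ProperLscConvex g) (hγ : 0 < γ) (hγL : γ * L < 1) (hσ : 0 < σ) (hζ : 0 < ζ) :
    Antitone fun k => fbe f g γ (x k) := by
  refine antitone_nat_of_succ_le fun k => (hrun.fbe_succ_le k).trans ?_
  have h1 := approxHess_nonneg hf hg hγ hγL (hrun.hess_mem k) (d k)
  have h2 : 0 ≤ regParam f g γ ζ (x k) * ‖d k‖ ^ 2 :=
    mul_nonneg (regParam_nonneg hζ _) (sq_nonneg _)
  have h3 := hrun.inner_gradient hf hg hγ hγL hζ k
  have h4 : ⟪gradient (fbe f g γ) (x k), d k⟫ ≤ 0 := by linarith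
  have h5 := mul_nonpos_of_nonneg_of_nonpos (mul_pos hσ (hrun.step_pos k)).le h4
  linarith

lemma fbe_le_of_mapClusterPt (hf : SmoothClass μ L f)
    (hg : ProperLscConvex g) (hγ : 0 < γ) (hanti : Antitone fun k => fbe f g γ (x k))
    (hxs : MapClusterPt xs atTop x) (k : ℕ) :
    fbe f g γ xs ≤ fbe f g γ (x k) := by
  by_contra! h
  have hc : ContinuousAt (fbe f g γ) xs := (hf.hasGradientAt_fbe hg hγ xs).continuousAt
  obtain ⟨j, hj, hkj⟩ := ((mapClusterPt_iff_frequently.1 hxs _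
    (hc.eventually (lt_mem_nhds h))).and_eventually (eventually_ge_atTop k)).exists
  exact absurd (hanti hkj) (not_le.2 hj)

/-- Armijo's condition holds for all small steps along uniformly gradient related directions. -/
lemma exists_armijo_of_descent {F : E → ℝ} {G : E → E} (hF : ∀ y, HasGradientAt F (G y) y)
    (hG : Continuous G) (a : E) {κ D : ℝ} (hκ : 0 < κ) (hσ : σ < 1) :
    ∃ t₀ > 0, ∀ᶠ y in 𝓝 a, ∀ v, ‖v‖ ≤ D → ⟪G y, v⟫ ≤ -κ * ‖v‖ → ∀ t, 0 < t → t ≤ t₀ →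
      F (y + t • v) ≤ F y + σ * t * ⟪G y, v⟫ := by
  -- Half of the slack `(1 - σ) κ` pays for the mean value error, the other half for replacing `G a`
  -- by `G y`.
  set ε := (1 - σ) * κ / 2 with hε
  have hε0 : 0 < ε := by have := sub_pos.2 hσ; positivity
  obtain ⟨r, hr, hball⟩ := Metric.eventually_nhds_iff.1 (Metric.tendsto_nhds.1 (hG.tendsto a) ε hε0)
  refine ⟨r / 2 / (|D| + 1), by positivity, ?_⟩
  filter_upwards [Metric.ball_mem_nhds a (half_pos hr)] with y hy v hvD hv t ht0 ht
  have h1 : ‖t • v‖ < r / 2 := by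
    rw [norm_smul, Real.norm_eq_abs, abs_of_pos ht0]
    rw [le_div_iff₀ (by positivity)] at ht
    have h2 : ‖v‖ ≤ |D| := hvD.trans (le_abs_self D)
    nlinarith [abs_nonneg D]
  have hyr : y ∈ Metric.ball a r := Metric.ball_subset_ball (by linarith) hy
  have hyt : y + t • v ∈ Metric.ball a r := by
    rw [Metric.mem_ball, dist_eq_norm] at hy ⊢
    calc ‖y + t • v - a‖ = ‖(y - a) + t • v‖ := by congr 1; abel
      _ ≤ ‖y - a‖ + ‖t • v‖ := norm_add_le _ _
      _ < r := by linarith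
  have hmv := (convex_ball a r).norm_image_sub_le_of_norm_hasFDerivWithin_le' (C := ε)
    (φ := InnerProductSpace.toDual ℝ E (G a))
    (fun z _ => (hF z).hasFDerivAt.hasFDerivWithinAt)
    (fun z hz => by
      rw [← map_sub, LinearIsometryEquiv.norm_map, ← dist_eq_norm]
      exact (hball hz).le) hyr hyt
  rw [add_sub_cancel_left, InnerProductSpace.toDual_apply_apply, inner_smul_right, norm_smul,
    Real.norm_eq_abs, Real.norm_eq_abs, abs_of_pos ht0] at hmv
  have h3 : |⟪G a - G y, v⟫| ≤ ε * ‖v‖ := by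
    refine (abs_real_inner_le_norm _ _).trans ?_
    gcongr
    rw [← dist_eq_norm, dist_comm]
    exact (hball hyr).le
  rw [inner_sub_left] at h3
  have h4 := mul_le_mul_of_nonneg_left (abs_le.1 h3).2 ht0.le
  have h5 := (abs_le.1 hmv).2
  have h6 := mul_le_mul_of_nonneg_left hv (mul_nonneg ht0.le (sub_pos.2 hσ).le)
  have h7 : 2 * ε = (1 - σ) * κ := by rw [hε]; ring
  have h8 : t * (1 - σ) * (-κ * ‖v‖) = - (2 * ε * (t * ‖v‖)) := by rw [h7]; ring
  nlinarith

/-- Nonsingular accumulation points are stationary. -/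
lemma IsRun.gradient_eq_zero (hrun : IsRun f g γ σ ηbar ζ ρ x H d τ) (hf : SmoothClass μ L f)
    (hg : ProperLscConvex g) (hγ : 0 < γ) (hγL : γ * L < 1) (hσ : σ ∈ Set.Ioo (0 : ℝ) (1 / 2))
    (hη : ηbar ∈ Set.Ioo (0 : ℝ) 1) (hζ : ζ ∈ Set.Ioo (0 : ℝ) 1)
    (hxs : MapClusterPt xs atTop x) {c : ℝ} (hc : 0 < c)
    (hpd : ∀ᶠ y in 𝓝 xs, ∀ V ∈ approxHess f g γ y, ∀ v, c * ‖v‖ ^ 2 ≤ ⟪V v, v⟫) :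
    gradient (fbe f g γ) xs = 0 := by
  by_contra hne
  have hanti := hrun.antitone_fbe hf hg hγ hγL hσ.1 hζ.1
  have hGc := hf.continuous_gradient_fbe hg hγ
  have hFG : ∀ y, HasGradientAt (fbe f g γ) (gradient (fbe f g γ) y) y := fun y =>
    (hf.hasGradientAt_fbe hg hγ y).differentiableAt.hasGradientAt
  set m := ‖gradient (fbe f g γ) xs‖ with hm
  have hm0 : 0 < m := norm_pos_iff.2 hne
  have h1η : 0 < 1 - ηbar := sub_pos.2 hη.2
  -- A lower bound for `‖d k‖` near `xs`: the accuracy test forces `‖w‖ ≥ (1 - ηbar) ‖G‖`, while the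
  -- regularized operator has norm at most `2 * γ⁻¹ + 2 * m`. The upper bound `4 * m / c` comes from
  -- `c ‖d‖² ≤ ‖G‖ ‖d‖`.
  set b := (1 - ηbar) * (m / 2) / (2 * γ⁻¹ + 2 * m) with hb
  have hb0 : 0 < b := by positivity
  obtain ⟨t₀, ht₀, harm⟩ := exists_armijo_of_descent hFG hGc xs (κ := c * b) (D := 4 * m / c)
    (by positivity) (by linarith [hσ.2] : σ < 1)
  obtain ⟨i, hi⟩ := exists_pow_lt_of_lt_one ht₀ (by norm_num : (1 / 2 : ℝ) < 1)
  set s : ℝ := (1 / 2 : ℝ) ^ i with hs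
  have hs0 : 0 < s := by positivity
  have hFc : ContinuousAt (fbe f g γ) xs := (hFG xs).continuousAt
  -- The right-hand margin is the decrease guaranteed by a stepsize of at least `s`; one step from
  -- such a point would fall below the value at `xs`.
  have e1 : ∀ᶠ y in 𝓝 xs, fbe f g γ y < fbe f g γ xs + σ * s * (c * b ^ 2) := by
    refine hFc.eventually (gt_mem_nhds ?_)
    have := hσ.1
    have : 0 < σ * s * (c * b ^ 2) := by positivity
    linarith
  have e2 : ∀ᶠ y in 𝓝 xs, m / 2 < ‖gradient (fbe f g γ) y‖ :=
    (hGc.norm.tendsto xs).eventually (lt_mem_nhds (by rw [← hm]; linarith))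
  have e3 : ∀ᶠ y in 𝓝 xs, ‖gradient (fbe f g γ) y‖ < 2 * m :=
    (hGc.norm.tendsto xs).eventually (gt_mem_nhds (by rw [← hm]; linarith))
  obtain ⟨k, hk1, hk2, hk3, hk4, hk5⟩ := (mapClusterPt_iff_frequently.1 hxs _
    (e1.and (e2.and (e3.and (harm.and hpd))))).exists
  have hpk := hk5 _ (hrun.hess_mem k) (d k)
  set δ := regParam f g γ ζ (x k) with hδ
  have hδ0 : 0 ≤ δ := regParam_nonneg hζ.1 _
  have hδm : δ ≤ 2 * m := by
    have : δ = ζ * ‖gradient (fbe f g γ) (x k)‖ := rfl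
    rw [this]
    nlinarith [hζ.1, hζ.2, norm_nonneg (gradient (fbe f g γ) (x k))]
  set G := gradient (fbe f g γ) (x k) with hG
  set w := H k (d k) + δ • d k with hw
  have hacc : ‖w + G‖ ≤ ηbar * ‖G‖ :=
    (hrun.dir_accuracy k).trans (mul_le_mul_of_nonneg_right (min_le_left _ _) (norm_nonneg _))
  have hinner := hrun.inner_gradient hf hg hγ hγL hζ.1 k
  have hwlow : (1 - ηbar) * ‖G‖ ≤ ‖w‖ := by
    have := norm_sub_le (w + G) w
    rw [add_sub_cancel_left] at this
    linarith
  have hwup : ‖w‖ ≤ (2 * γ⁻¹ + 2 * m) * ‖d k‖ := by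
    refine (norm_add_le _ _).trans ?_
    have h1 := norm_approxHess_apply_le hf hg hγ hγL (hrun.hess_mem k) (d k)
    rw [norm_smul, Real.norm_eq_abs, abs_of_nonneg hδ0]
    have h2 := mul_le_mul_of_nonneg_right hδm (norm_nonneg (d k))
    linarith
  have hdlow : b ≤ ‖d k‖ := by
    rw [hb, div_le_iff₀ (by positivity)]
    have := mul_le_mul_of_nonneg_left hk2.le h1η.le
    linarith
  have hd0 : 0 < ‖d k‖ := hb0.trans_le hdlow
  have hδd : 0 ≤ δ * ‖d k‖ ^ 2 := mul_nonneg hδ0 (sq_nonneg _)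
  have hdup : ‖d k‖ ≤ 4 * m / c := by
    rw [le_div_iff₀ hc]
    have h1 : ‖G‖ ≤ 2 * m := hk3.le
    have h3 := (abs_le.1 (abs_real_inner_le_norm G (d k))).1
    have h4 : c * ‖d k‖ ^ 2 ≤ ‖G‖ * ‖d k‖ := by linarith
    have h5 : c * ‖d k‖ ≤ ‖G‖ := by
      by_contra! h6
      nlinarith
    linarith
  have hdesc : ⟪G, d k⟫ ≤ -(c * b) * ‖d k‖ := by
    have : c * b * ‖d k‖ ≤ c * ‖d k‖ ^ 2 := by
      rw [mul_assoc, sq]; gcongr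
    linarith
  have hτ : s ≤ τ k := (hrun.step_armijo k).2 ⟨⟨i, rfl⟩, hk4 _ hdup hdesc s hs0 hi.le⟩
  have hfin := hrun.fbe_succ_le k
  have hlow := fbe_le_of_mapClusterPt hf hg hγ hanti hxs (k + 1)
  have h7 : c * b ^ 2 ≤ -⟪G, d k⟫ := by
    have : c * b ^ 2 ≤ c * ‖d k‖ ^ 2 := by gcongr
    linarith
  have h8 : σ * s * (c * b ^ 2) ≤ σ * τ k * -⟪G, d k⟫ := by
    have := hσ.1
    have := hrun.step_pos k
    gcongr
  linarith

/-- The forward Jacobian is bounded below by `1 - γ L > 0`, hence injective. -/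
lemma SmoothClass.fbRes_eq_zero (hf : SmoothClass μ L f) (hg : ProperLscConvex g) (hγ : 0 < γ)
    (hγL : γ * L < 1) (h : gradient (fbe f g γ) xs = 0) : fbRes f g γ xs = 0 := by
  rw [hf.gradient_fbe hg hγ, smul_eq_zero_iff_right (inv_pos.2 hγ).ne'] at h
  have h1 := hf.norm_le_fwdJac_apply hγ xs (fbRes f g γ xs)
  rw [h, norm_zero] at h1
  have h2 : 0 < 1 - γ * L := sub_pos.2 hγL
  have h3 : ‖fbRes f g γ xs‖ ≤ 0 := by
    by_contra! h4
    have := mul_pos h2 h4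
    linarith
  simpa using h3

lemma SmoothClass.norm_gradient_fbe_le (hf : SmoothClass μ L f) (hg : ProperLscConvex g)
    (hγ : 0 < γ) (hγL : γ * L < 1) (hxs : fbRes f g γ xs = 0) (y : E) :
    ‖gradient (fbe f g γ) y‖ ≤ 3 * γ⁻¹ * ‖y - xs‖ := by
  have h1 := hf.norm_fbRes_sub_le hg hγ hγL y xs
  rw [hxs, sub_zero] at h1
  rw [hf.gradient_fbe hg hγ, norm_smul, Real.norm_eq_abs, abs_of_pos (inv_pos.2 hγ)]
  have h2 := (hf.norm_fwdJac_apply_le hγ hγL y (fbRes f g γ y)).trans h1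
  calc _ ≤ γ⁻¹ * (3 * ‖y - xs‖) := by gcongr
    _ = _ := by ring

/-- Distance to `a` after an inexact regularized Newton step. -/
lemma norm_newton_step_le {V : E →L[ℝ] E} {c δ η : ℝ} (hδ : 0 ≤ δ)
    (hV : ∀ v, c * ‖v‖ ^ 2 ≤ ⟪V v, v⟫) {G y v a : E}
    (hacc : ‖(V + δ • (1 : E →L[ℝ] E)) v + G‖ ≤ η * ‖G‖) :
    c * ‖y + v - a‖ ≤ ‖G - V (y - a)‖ + δ * ‖y - a‖ + η * ‖G‖ := by
  set A := V + δ • (1 : E →L[ℝ] E) with hA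
  have hAv : ∀ u, A u = V u + δ • u := fun u => rfl
  -- Three sources of error: the inexact solve, the linearization and the regularization. The lower
  -- bound `c` of the form then inverts `A`.
  have e : A (y + v - a) = (A v + G) - (G - V (y - a)) + δ • (y - a) := by
    rw [show y + v - a = v + (y - a) by abel, map_add, hAv (y - a)]
    abel
  have h1 : ‖A (y + v - a)‖ ≤ ‖G - V (y - a)‖ + δ * ‖y - a‖ + η * ‖G‖ := by
    rw [e]
    refine (norm_add_le _ _).trans ?_
    have := norm_sub_le (A v + G) (G - V (y - a))
    rw [norm_smul, Real.norm_eq_abs, abs_of_nonneg hδ]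
    linarith
  refine le_trans ?_ h1
  set u := y + v - a
  have h2 := hV u
  have h3 := real_inner_le_norm (A u) u
  rw [hAv, inner_add_left, inner_smul_left, conj_trivial, real_inner_self_eq_norm_sq,
    ← hAv] at h3
  have h4 : 0 ≤ δ * ‖u‖ ^ 2 := mul_nonneg hδ (sq_nonneg _)
  rcases (norm_nonneg u).eq_or_lt with h0 | h0
  · rw [← h0, mul_zero]; exact norm_nonneg _
  · by_contra! h5
    nlinarith

end Run

/-! ### Acceptance of unit steps, convergence and rates. -/

section Rate

set_option linter.unusedSectionVars false

open RealInnerProductSpace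

variable {E : Type*} [NormedAddCommGroup E] [InnerProductSpace ℝ E] [CompleteSpace E]
  [FiniteDimensional ℝ E]
  {f : E → ℝ} {g : E → EReal} {γ μ σ ηbar ζ ρ : ℝ} {L : NNReal} {xs : E}
  {x : ℕ → E} {H : ℕ → E →L[ℝ] E} {d : ℕ → E} {τ : ℕ → ℝ}

lemma IsRun.full_step_le (hrun : IsRun f g γ σ ηbar ζ ρ x H d τ) (hζ : ζ ∈ Set.Ioo (0 : ℝ) 1)
    {c : ℝ} {k : ℕ} (hpd : ∀ V ∈ approxHess f g γ (x k), ∀ v, c * ‖v‖ ^ 2 ≤ ⟪V v, v⟫) :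
    c * ‖x k + d k - xs‖ ≤ ‖gradient (fbe f g γ) (x k) - H k (x k - xs)‖ +
      ‖gradient (fbe f g γ) (x k)‖ * ‖x k - xs‖ +
      ‖gradient (fbe f g γ) (x k)‖ ^ ρ * ‖gradient (fbe f g γ) (x k)‖ := by
  refine (norm_newton_step_le (regParam_nonneg hζ.1 (x k)) (hpd _ (hrun.hess_mem k))
    (hrun.dir_accuracy k)).trans ?_
  gcongr
  · exact mul_le_of_le_one_left (norm_nonneg _) hζ.2.le
  · exact min_le_right _ _

/-- Quantified over points near `xs` instead of large indices, because convergence of the sequence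
is not yet known and is itself deduced from this estimate. -/
lemma IsRun.eventually_full_step (hrun : IsRun f g γ σ ηbar ζ ρ x H d τ)
    (hf : SmoothClass μ L f) (hg : ProperLscConvex g) (hγ : 0 < γ) (hγL : γ * L < 1)
    (hζ : ζ ∈ Set.Ioo (0 : ℝ) 1) (hρ : 0 < ρ)
    (hsemi : SemismoothAt (prox γ g) (xs - γ • gradient f xs))
    (hG : gradient (fbe f g γ) xs = 0) {c : ℝ} (hc : 0 < c)
    (hpd : ∀ᶠ y in 𝓝 xs, ∀ V ∈ approxHess f g γ y, ∀ v, c * ‖v‖ ^ 2 ≤ ⟪V v, v⟫)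
    {ε : ℝ} (hε : 0 < ε) :
    ∀ᶠ y in 𝓝 xs, ∀ k, x k = y → ‖x k + d k - xs‖ ≤ ε * ‖x k - xs‖ := by
  have hres := hf.fbRes_eq_zero hg hγ hγL hG
  have hlim : Tendsto (fun y => ‖gradient (fbe f g γ) y‖ +
      ‖gradient (fbe f g γ) y‖ ^ ρ * (3 * γ⁻¹)) (𝓝 xs) (𝓝 0) := by
    have hn := (hf.continuous_gradient_fbe hg hγ).norm
    have h1 : Continuous fun y => ‖gradient (fbe f g γ) y‖ +
        ‖gradient (fbe f g γ) y‖ ^ ρ * (3 * γ⁻¹) :=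
      hn.add ((hn.rpow_const fun _ => Or.inr hρ.le).mul continuous_const)
    have h2 := h1.tendsto xs
    rwa [hG, norm_zero, Real.zero_rpow hρ.ne', zero_mul, add_zero] at h2
  have hcε : 0 < c * ε / 2 := by positivity
  filter_upwards [hpd, hf.eventually_newton hg hγ hγL hres hsemi hcε,
    hlim.eventually (gt_mem_nhds hcε)] with y hy1 hy2 hy3 k hk
  subst hk
  have h1 := hrun.full_step_le (xs := xs) hζ hy1
  have h2 := hy2 _ (hrun.hess_mem k)
  have h3 := hf.norm_gradient_fbe_le hg hγ hγL hres (x k)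
  have h4 := mul_le_mul_of_nonneg_right hy3.le (norm_nonneg (x k - xs))
  have h5 := mul_le_mul_of_nonneg_left h3
    (Real.rpow_nonneg (norm_nonneg (gradient (fbe f g γ) (x k))) ρ)
  have h6 : c * ‖x k + d k - xs‖ ≤ c * (ε * ‖x k - xs‖) := by linarith
  exact le_of_mul_le_mul_left h6 hc

lemma IsRun.exists_full_step_order (hrun : IsRun f g γ σ ηbar ζ ρ x H d τ)
    (hf : SmoothClass μ L f) (hg : ProperLscConvex g) (hγ : 0 < γ) (hγL : γ * L < 1)
    (hζ : ζ ∈ Set.Ioo (0 : ℝ) 1) (hρ : ρ ∈ Set.Ioc (0 : ℝ) 1)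
    (hsemi : StronglySemismoothAt (prox γ g) (xs - γ • gradient f xs))
    (hl : LipschitzAround (hess f) xs)
    (hG : gradient (fbe f g γ) xs = 0) {c : ℝ} (hc : 0 < c)
    (hpd : ∀ᶠ y in 𝓝 xs, ∀ V ∈ approxHess f g γ y, ∀ v, c * ‖v‖ ^ 2 ≤ ⟪V v, v⟫) :
    ∃ C : ℝ, ∀ᶠ y in 𝓝 xs, ∀ k, x k = y →
      ‖x k + d k - xs‖ ≤ C * ‖x k - xs‖ ^ (1 + ρ) := by
  have hres := hf.fbRes_eq_zero hg hγ hγL hG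
  obtain ⟨C, hC0, hC⟩ := hf.eventually_newton_strong hg hγ hγL hres hsemi hl
  set M := 3 * γ⁻¹ with hM
  have hM0 : 0 ≤ M := by positivity
  refine ⟨(C + M + M ^ ρ * M) / c, ?_⟩
  filter_upwards [hpd, hC, Metric.ball_mem_nhds xs one_pos] with y hy1 hy2 hy3 k hk
  subst hk
  have h1 := hrun.full_step_le (xs := xs) hζ hy1
  have h2 := hy2 _ (hrun.hess_mem k)
  have h3 := hf.norm_gradient_fbe_le hg hγ hγL hres (x k)
  rw [← hM] at h3
  rw [Metric.mem_ball, dist_eq_norm] at hy3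
  set e := ‖x k - xs‖ with he
  have he0 : 0 ≤ e := norm_nonneg _
  have hpow : e ^ ρ * e = e ^ (1 + ρ) := by
    rw [Real.rpow_add' he0 (by linarith [hρ.1]), Real.rpow_one, mul_comm]
  -- The linearization and regularization errors are quadratic and are absorbed since `ρ ≤ 1` and `e
  -- < 1`; the forcing term alone has order `1 + ρ`.
  have hsq : e ^ 2 ≤ e ^ (1 + ρ) := by
    rw [← Real.rpow_natCast]
    exact Real.rpow_le_rpow_of_exponent_ge_of_imp he0 hy3.le
      (by push_cast; linarith [hρ.2]) fun _ h => absurd h (by norm_num)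
  have h4 : ‖gradient (fbe f g γ) (x k)‖ * e ≤ M * e ^ (1 + ρ) := by
    calc _ ≤ M * e * e := by gcongr
      _ = M * e ^ 2 := by ring
      _ ≤ _ := by gcongr
  have h5 : ‖gradient (fbe f g γ) (x k)‖ ^ ρ * ‖gradient (fbe f g γ) (x k)‖ ≤
      M ^ ρ * M * e ^ (1 + ρ) := by
    calc _ ≤ (M * e) ^ ρ * (M * e) := by
          have := Real.rpow_le_rpow (norm_nonneg _) h3 hρ.1.le
          gcongr
      _ = _ := by rw [Real.mul_rpow hM0 he0, ← hpow]; ring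
  have h6 := h2.trans (mul_le_mul_of_nonneg_left hsq hC0)
  rw [div_mul_eq_mul_div, le_div_iff₀ hc]
  linarith

/-- Near a nonsingular stationary point the full Newton step passes Armijo's test. -/
lemma IsRun.eventually_unit_step (hrun : IsRun f g γ σ ηbar ζ ρ x H d τ)
    (hf : SmoothClass μ L f) (hg : ProperLscConvex g) (hγ : 0 < γ) (hγL : γ * L < 1)
    (hσ : σ ∈ Set.Ioo (0 : ℝ) (1 / 2)) (hζ : ζ ∈ Set.Ioo (0 : ℝ) 1) (hρ : 0 < ρ)
    (hsemi : SemismoothAt (prox γ g) (xs - γ • gradient f xs))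
    (hG : gradient (fbe f g γ) xs = 0) {c : ℝ} (hc : 0 < c)
    (hpd : ∀ᶠ y in 𝓝 xs, ∀ V ∈ approxHess f g γ y, ∀ v, c * ‖v‖ ^ 2 ≤ ⟪V v, v⟫) :
    ∀ᶠ y in 𝓝 xs, ∀ k, x k = y → τ k = 1 := by
  have hres := hf.fbRes_eq_zero hg hγ hγL hG
  set M := 3 * γ⁻¹ with hM
  have hM0 : 0 ≤ M := by positivity
  have hσ' : 0 < 1 / 2 - σ := sub_pos.2 hσ.2
  -- With `h` the old and `u` the new error, the trapezoidal rule gives `F(x) - F(xs) ≈ ½⟪G, h⟫`,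
  -- while `F(x + d) - F(xs)` is `O(ε ‖h‖²)` and `⟪G, d⟫ ≈ -⟪G, h⟫`. Armijo's test thus has the
  -- margin `(1/2 - σ)⟪G, h⟫`, about `(1/2 - σ) c ‖h‖²`, and all errors add up to at most `(M + 3) ε
  -- ‖h‖²`.
  set ε := min 1 ((1 / 2 - σ) * c / (M + 3)) with hε
  have hε0 : 0 < ε := lt_min one_pos (by positivity)
  have hε1 : ε ≤ 1 := min_le_left _ _
  have hεc : ε * (M + 3) ≤ (1 / 2 - σ) * c := by
    rw [← le_div_iff₀ (by positivity)]; exact min_le_right _ _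
  obtain ⟨r, hr, hball⟩ := Metric.eventually_nhds_iff.1
    (hf.eventually_fbe_trapezoid hg hγ hγL hres hsemi hε0)
  filter_upwards [Metric.ball_mem_nhds xs hr, hpd,
    hf.eventually_newton hg hγ hγL hres hsemi hε0,
    hrun.eventually_full_step hf hg hγ hγL hζ hρ hsemi hG hc hpd hε0] with y hy1 hy2 hy3 hy4 k hk
  subst hk
  refine le_antisymm (hrun.step_le_one k) ((hrun.step_armijo k).2 ⟨⟨0, by simp⟩, ?_⟩)
  rw [one_smul, mul_one]
  have hstep := hy4 k rfl
  have hnew := hy3 _ (hrun.hess_mem k)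
  have hpos := hy2 _ (hrun.hess_mem k) (x k - xs)
  have htr := (abs_le.1 (hball hy1)).1
  have hmem : dist (x k + d k) xs < r := by
    rw [Metric.mem_ball, dist_eq_norm] at hy1
    rw [dist_eq_norm]
    nlinarith [norm_nonneg (x k - xs)]
  have htr' := (abs_le.1 (hball hmem)).2
  have hGd := hf.norm_gradient_fbe_le hg hγ hγL hres (x k)
  have hGd' := hf.norm_gradient_fbe_le hg hγ hγL hres (x k + d k)
  rw [← hM] at hGd hGd'
  set G := gradient (fbe f g γ) (x k)
  set G' := gradient (fbe f g γ) (x k + d k)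
  set h := x k - xs with hh
  set u := x k + d k - xs with hu
  have hdk : d k = u - h := by rw [hu, hh]; abel
  have hu2 : ‖u‖ ^ 2 ≤ ε * ‖h‖ ^ 2 := by
    calc ‖u‖ ^ 2 ≤ (ε * ‖h‖) ^ 2 := by gcongr
      _ = ε * (ε * ‖h‖ ^ 2) := by ring
      _ ≤ ε * (1 * ‖h‖ ^ 2) := by gcongr
      _ = _ := by ring
  have i1 : ⟪G', u⟫ ≤ M * ‖u‖ ^ 2 := by
    calc _ ≤ ‖G'‖ * ‖u‖ := real_inner_le_norm _ _
      _ ≤ M * ‖u‖ * ‖u‖ := by gcongr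
      _ = _ := by ring
  have i2 : -(M * (ε * ‖h‖ ^ 2)) ≤ ⟪G, u⟫ := by
    have h1 : ‖G‖ * ‖u‖ ≤ M * (ε * ‖h‖ ^ 2) := by
      calc ‖G‖ * ‖u‖ ≤ (M * ‖h‖) * (ε * ‖h‖) := by gcongr
        _ = _ := by ring
    linarith [(abs_le.1 (abs_real_inner_le_norm G u)).1]
  have i3 : (c - ε) * ‖h‖ ^ 2 ≤ ⟪G, h⟫ := by
    have h1 := (abs_le.1 (abs_real_inner_le_norm (G - H k h) h)).1
    rw [inner_sub_left] at h1
    have h2 := mul_le_mul_of_nonneg_right hnew (norm_nonneg h)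
    linarith
  have i4 : fbe f g γ (x k + d k) - fbe f g γ xs ≤ (M / 2 + 1) * (ε * ‖h‖ ^ 2) := by
    have h1 : ε * ‖u‖ ^ 2 ≤ 1 * ‖u‖ ^ 2 := by gcongr
    have h2 : (M / 2 + 1) * ‖u‖ ^ 2 ≤ (M / 2 + 1) * (ε * ‖h‖ ^ 2) := by gcongr
    linarith
  have i5 : ⟪G, d k⟫ = ⟪G, u⟫ - ⟪G, h⟫ := by rw [hdk, inner_sub_right]
  rw [i5]
  have j1 := mul_le_mul_of_nonneg_left i2 hσ.1.le
  have j2 := mul_le_mul_of_nonneg_left i3 hσ'.le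
  have j3 := mul_le_mul_of_nonneg_right hεc (sq_nonneg ‖h‖)
  have j4 : 0 ≤ ε * ‖h‖ ^ 2 := by positivity
  have j5 : 0 ≤ M * (ε * ‖h‖ ^ 2) := by positivity
  have j6 := mul_le_mul_of_nonneg_right hσ.2.le j5
  have j7 := mul_nonneg hσ.1.le j4
  linarith

/-- A single iterate inside the ball of contraction suffices: the later ones stay there and their
distance to `xs` at least halves each time. -/
lemma tendsto_of_eventually_contraction (hxs : MapClusterPt xs atTop x)
    (h : ∀ᶠ y in 𝓝 xs, ∀ k, x k = y → ‖x (k + 1) - xs‖ ≤ 1 / 2 * ‖x k - xs‖) :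
    Tendsto x atTop (𝓝 xs) := by
  obtain ⟨r, hr, hball⟩ := Metric.eventually_nhds_iff.1 h
  obtain ⟨k₀, hk₀⟩ := (mapClusterPt_iff_frequently.1 hxs _ (Metric.ball_mem_nhds xs hr)).exists
  have hind : ∀ j : ℕ, ‖x (j + k₀) - xs‖ ≤ (1 / 2) ^ j * ‖x k₀ - xs‖ := by
    intro j
    induction j with
    | zero => simp
    | succ j ih =>
      have h1 : dist (x (j + k₀)) xs < r := by
        rw [Metric.mem_ball, dist_eq_norm] at hk₀
        rw [dist_eq_norm]
        have : ((1 : ℝ) / 2) ^ j * ‖x k₀ - xs‖ ≤ ‖x k₀ - xs‖ :=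
          mul_le_of_le_one_left (norm_nonneg _) (pow_le_one₀ (by norm_num) (by norm_num))
        linarith
      have h2 := hball h1 _ rfl
      rw [Nat.succ_add_eq_add_succ] at *
      calc ‖x (j + k₀ + 1) - xs‖ ≤ 1 / 2 * ‖x (j + k₀) - xs‖ := h2
        _ ≤ 1 / 2 * ((1 / 2) ^ j * ‖x k₀ - xs‖) := by gcongr
        _ = _ := by ring
  rw [← tendsto_add_atTop_iff_nat k₀, tendsto_iff_norm_sub_tendsto_zero]
  refine squeeze_zero (fun _ => norm_nonneg _) hind ?_
  simpa using (tendsto_pow_atTop_nhds_zero_of_lt_one (by norm_num : (0 : ℝ) ≤ 1 / 2)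
    (by norm_num)).mul_const ‖x k₀ - xs‖

/-- Local convergence of the forward-backward Newton-CG method. -/
theorem IsRun.local_convergence (hrun : IsRun f g γ σ ηbar ζ ρ x H d τ)
    (hf : SmoothClass μ L f) (hg : ProperLscConvex g) (hγ : 0 < γ) (hγL : γ * L < 1)
    (hσ : σ ∈ Set.Ioo (0 : ℝ) (1 / 2)) (hη : ηbar ∈ Set.Ioo (0 : ℝ) 1)
    (hζ : ζ ∈ Set.Ioo (0 : ℝ) 1) (hρ : ρ ∈ Set.Ioc (0 : ℝ) 1)
    (hxs : MapClusterPt xs atTop x)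
    (hsemi : SemismoothAt (prox γ g) (xs - γ • gradient f xs))
    (hns : ∀ V ∈ approxHess f g γ xs, IsUnit V) :
    QSuperlinear x xs ∧ (StronglySemismoothAt (prox γ g) (xs - γ • gradient f xs) →
      LipschitzAround (hess f) xs → QOrderAtLeast (1 + ρ) x xs) := by
  obtain ⟨c, hc, hpd⟩ := hf.exists_approxHess_ge hg hγ hγL hns
  have hG := hrun.gradient_eq_zero hf hg hγ hγL hσ hη hζ hxs hc hpd
  have hunit : ∀ᶠ y in 𝓝 xs, ∀ k, x k = y → x (k + 1) = x k + d k := by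
    filter_upwards [hrun.eventually_unit_step hf hg hγ hγL hσ hζ hρ.1 hsemi hG hc hpd]
      with y hy k hk
    rw [hrun.update, hy k hk, one_smul]
  have hlin : ∀ ε > 0, ∀ᶠ y in 𝓝 xs, ∀ k, x k = y →
      ‖x (k + 1) - xs‖ ≤ ε * ‖x k - xs‖ := by
    intro ε hε
    filter_upwards [hunit, hrun.eventually_full_step hf hg hγ hγL hζ hρ.1 hsemi hG hc hpd hε]
      with y hy1 hy2 k hk
    rw [hy1 k hk]; exact hy2 k hk
  have hlim : Tendsto x atTop (𝓝 xs) :=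
    tendsto_of_eventually_contraction hxs (hlin _ (by norm_num))
  refine ⟨⟨hlim, isLittleO_iff.2 fun ε hε => ?_⟩, fun hstrong hl => ⟨hlim, ?_⟩⟩
  · exact (hlim.eventually (hlin ε hε)).mono fun k hk => hk k rfl
  · obtain ⟨C, hC⟩ := hrun.exists_full_step_order hf hg hγ hγL hζ hρ hstrong hl hG hc hpd
    refine ⟨C, ?_⟩
    filter_upwards [hlim.eventually hC, hlim.eventually hunit] with k hk1 hk2
    rw [hk2 k rfl]; exact hk1 k rfl

end Rate

end FBNCG

theorem mainTheorem7 (n : ℕ)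
    (f : EuclideanSpace ℝ (Fin n) → ℝ) (g : EuclideanSpace ℝ (Fin n) → EReal)
    (μ : ℝ) (L : NNReal)
    (hf : FBNCG.SmoothClass μ L f) (hg : FBNCG.ProperLscConvex g)
    (γ σ ηbar ζ ρ : ℝ)
    -- the condition `γ < 1 / L`, read as no upper bound if `L = 0`
    (hγ : 0 < γ) (hγL : γ * L < 1)
    (hσ : σ ∈ Set.Ioo (0 : ℝ) (1 / 2)) (hη : ηbar ∈ Set.Ioo (0 : ℝ) 1)
    (hζ : ζ ∈ Set.Ioo (0 : ℝ) 1) (hρ : ρ ∈ Set.Ioc (0 : ℝ) 1)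
    (x : ℕ → EuclideanSpace ℝ (Fin n))
    (H : ℕ → EuclideanSpace ℝ (Fin n) →L[ℝ] EuclideanSpace ℝ (Fin n))
    (d : ℕ → EuclideanSpace ℝ (Fin n)) (τ : ℕ → ℝ)
    (hrun : FBNCG.IsRun f g γ σ ηbar ζ ρ x H d τ)
    (xs : EuclideanSpace ℝ (Fin n)) (hxs : MapClusterPt xs atTop x)
    (hsemi : FBNCG.SemismoothAt (FBNCG.prox γ g) (xs - γ • gradient f xs))
    (hns : ∀ V ∈ FBNCG.approxHess f g γ xs, IsUnit V) :
    FBNCG.QSuperlinear x xs ∧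
      (FBNCG.StronglySemismoothAt (FBNCG.prox γ g) (xs - γ • gradient f xs) →
        FBNCG.LipschitzAround (FBNCG.hess f) xs →
        FBNCG.QOrderAtLeast (1 + ρ) x xs) :=
  hrun.local_convergence hf hg hγ hγL hσ hη hζ hρ hxs hsemi hns
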